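/- Let $(\Omega,d,\mu)$ be an RD-space with indices $(k,n)$: a metric space with a Borel measure such that every ball has positive finite measure, $\mu(\{x\})=0$ for all $x$, and, for some $0<C_1\le 1\le C_2$ and $0<k\le n$, $C_1\lambda^k\mu(B(x,r))\le\mu(B(x,\lambda r))\le C_2\lambda^n\mu(B(x,r))$ for all $x\in\Omega$, $r>0$, $\lambda\ge1$. Assume that it is non-collapsing: $\inf_x\mu(B(x,1))>0$. Let $X$ be a rearrangement invariant (r.i.) space on $\Omega$ (a Banach function space with the Fatou property whose norm is monotone with respect to decreasing rearrangements), with fundamental function $\phi_X(t)=\|\chi_F\|_X$, $\mu(F)=t$. Let $M(t)=\sup_{s>0}\phi_X(st)/\phi_X(s)$, and let $\underline\beta_X=\lim_{t\to0}\frac{\log M(t)}{\log t}$ and $\overline\beta_X=\lim_{t\to\infty}\frac{\log M(t)}{\log t}$ be its fundamental indices. Let $E$ be an r.i. space on $(0,\infty)$ with Lebesgue measure, and let $\tilde E$ be the corresponding space for the measure $dt/t$, so that $\|g\|_{\tilde E(0,1)}=\|g(e^{-u})\|_{E(0,\infty)}$ and $\|g\|_{\tilde E(1,\infty)}=\|g(e^{u})\|_{E(0,\infty)}$;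 let $\tilde E'$ be the associate space of $\tilde E$ with respect to $dt/t$. Let $b$ be slowly varying on $(0,\infty)$: positive, measurable, and for every $\varepsilon>0$ the functions $t^{\varepsilon}b(t)$ and $t^{-\varepsilon}b(t)$ are equivalent (up to multiplicative constants) to an increasing and to a decreasing function, respectively. Let $0<\theta<1$ and put $$E_X(f,t)=\Big\|\frac1{\mu(B(x,t))}\int_{B(x,t)}|f(x)-f(y)|\,d\mu(y)\Big\|_X,\qquad \|f\|_{B_{X,E}^{\theta,b}}=\big\|t^{-\theta}b(t)E_X(f,t)\big\|_{\tilde E(0,1)}+\|f\|_X .$$ Let $B_{X,E}^{\theta,b}$ be the space of all $f\in X$, $f\in L^1+L^\infty$, with $t^{-\theta}b(t)E_X(f,t)\in\tilde E$. Then: (i) If $\underline\beta_X=\theta/n$ and $\Big\|\dfrac{t^{\theta/n}}{b(t^{1/n})\phi_X(t)}\Big\|_{\tilde E'(0,1)}<\infty$, then every $f\in B_{X,E}^{\theta,b}$ is essentially continuous, that is, equal almost everywhere to a continuous function. (ii) If $\underline\beta_X<\theta/n$, then for every $\gamma$ with $\overline\beta_X\le\gamma\le1$ and $\gamma<\theta/n$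 for which $\phi_X(t)/t^{\gamma}$ is equivalent to a decreasing function on $(0,\infty)$, there is a constant $C>0$ such that every $f\in B_{X,E}^{\theta,b}$, after modification on a null set, satisfies $$|f(x)-f(y)|\le C\,\|f\|_{B_{X,E}^{\theta,b}}\,\frac{d(x,y)^{\theta-\gamma n}}{b(d(x,y))}\qquad\text{for all }x\ne y\text{ in }\Omega .$$ -/

import Mathlib

open MeasureTheory Set Filter Topology
open scoped ENNReal NNReal

namespace HajlaszBesov

/-- An RD-space with indices `(k, n)`: a metric space with a Borel measure for which every ball has
positive finite measure, points are null, and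
`C₁ λ ^ k μ(B(x,r)) ≤ μ(B(x,λr)) ≤ C₂ λ ^ n μ(B(x,r))` for all `x`, `r > 0`, `λ ≥ 1`. -/
structure IsRDSpace {Ω : Type*} [MetricSpace Ω] [MeasurableSpace Ω]
    (μ : Measure Ω) (k n : ℝ) : Prop where
  ball_pos : ∀ (x : Ω) (r : ℝ), 0 < r → 0 < μ (Metric.ball x r)
  ball_lt_top : ∀ (x : Ω) (r : ℝ), 0 < r → μ (Metric.ball x r) < ∞
  atom_free : ∀ x : Ω, μ {x} = 0
  lower_pos : 0 < k
  lower_le_upper : k ≤ n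
  growth : ∃ C₁ C₂ : ℝ, 0 < C₁ ∧ C₁ ≤ 1 ∧ 1 ≤ C₂ ∧
    ∀ (x : Ω) (r l : ℝ), 0 < r → 1 ≤ l →
      ENNReal.ofReal (C₁ * l ^ k) * μ (Metric.ball x r) ≤ μ (Metric.ball x (l * r)) ∧
      μ (Metric.ball x (l * r)) ≤ ENNReal.ofReal (C₂ * l ^ n) * μ (Metric.ball x r)

/-- The non-collapsing property: `inf_x μ(B(x,1)) > 0`. -/
def IsNonCollapsing {Ω : Type*} [MetricSpace Ω] [MeasurableSpace Ω] (μ : Measure Ω) : Prop :=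
  0 < ⨅ x : Ω, μ (Metric.ball x 1)

/-- The decreasing rearrangement `f^*(s) = inf {t ≥ 0 : μ {f > t} ≤ s}` of a nonnegative
function. -/
noncomputable def rearrangement {α : Type*} [MeasurableSpace α] (μ : Measure α)
    (f : α → ℝ≥0∞) (s : ℝ) : ℝ≥0∞ :=
  sInf {t : ℝ≥0∞ | μ {x | t < f x} ≤ ENNReal.ofReal s}

/-- A Banach function norm with the Fatou property, given on the (a.e.) measurable functions with
values in `[0, ∞]`. The space it defines consists of the functions `f` with `‖|f|‖ < ∞`. -/
structure BanachFunctionNorm {α : Type*} [MeasurableSpace α] (μ : Measure α) where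
  /-- The norm of a nonnegative function. -/
  nrm : (α → ℝ≥0∞) → ℝ≥0∞
  nrm_eq_zero_iff : ∀ f, AEMeasurable f μ → (nrm f = 0 ↔ f =ᵐ[μ] 0)
  nrm_const_mul : ∀ (c : ℝ≥0) (f : α → ℝ≥0∞), AEMeasurable f μ →
    nrm (fun x => c * f x) = c * nrm f
  nrm_add_le : ∀ f g, AEMeasurable f μ → AEMeasurable g μ →
    nrm (fun x => f x + g x) ≤ nrm f + nrm g
  nrm_mono : ∀ f g, AEMeasurable f μ → AEMeasurable g μ → f ≤ᵐ[μ] g → nrm f ≤ nrm g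
  fatou : ∀ u : ℕ → α → ℝ≥0∞, (∀ i, AEMeasurable (u i) μ) → Monotone u →
    nrm (fun x => ⨆ i, u i x) = ⨆ i, nrm (u i)
  nrm_indicator_lt_top : ∀ A : Set α, MeasurableSet A → μ A < ∞ →
    nrm (A.indicator fun _ => 1) < ∞
  setLIntegral_le : ∀ A : Set α, MeasurableSet A → μ A < ∞ →
    ∃ C : ℝ≥0, ∀ f, AEMeasurable f μ → ∫⁻ x in A, f x ∂μ ≤ C * nrm f

/-- A rearrangement invariant (r.i.) space. -/
structure RISpace {α : Type*} [MeasurableSpace α] (μ : Measure α) extends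
    BanachFunctionNorm μ where
  rearrangement_invariant : ∀ f g, AEMeasurable f μ → AEMeasurable g μ →
    (∀ᵐ s ∂(volume.restrict (Ioi (0 : ℝ))), rearrangement μ f s ≤ rearrangement μ g s) →
    nrm f ≤ nrm g

/-- A parameter: an r.i. space on `(0, ∞)` with Lebesgue measure. -/
abbrev Parameter : Type := RISpace (volume.restrict (Ioi (0 : ℝ)))

section Spaces

variable {α : Type*} [MeasurableSpace α] {μ : Measure α}

/-- The norm of a real-valued function. -/
noncomputable def RISpace.realNorm (X : RISpace μ) (f : α → ℝ) : ℝ≥0∞ :=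
  X.nrm fun x => ‖f x‖ₑ

/-- The associate norm `‖h‖_{X'} = sup {∫ h g dμ : ‖g‖_X ≤ 1}` of a nonnegative function. -/
noncomputable def RISpace.assocNorm (X : RISpace μ) (h : α → ℝ≥0∞) : ℝ≥0∞ :=
  ⨆ (g : α → ℝ≥0∞) (_ : AEMeasurable g μ) (_ : X.nrm g ≤ 1), ∫⁻ x, h x * g x ∂μ

/-- The fundamental function `φ_X(t) = ‖χ_F‖_X`, where `μ(F) = t`; by rearrangement invariance the
value is the same for all such `F`. -/
noncomputable def RISpace.fundamental (X : RISpace μ) (t : ℝ) : ℝ :=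
  (⨆ (F : Set α) (_ : MeasurableSet F) (_ : μ F = ENNReal.ofReal t),
    X.nrm (F.indicator fun _ => 1)).toReal

end Spaces

/-- For a parameter `E`, the norm `‖g‖_{Ẽ(0,1)} = ‖u ↦ g(e^{-u})‖_{E(0,∞)}` of the corresponding
space over `(0, 1)` with the measure `dt/t`. -/
noncomputable def tildeNormZeroOne (E : Parameter) (g : ℝ → ℝ≥0∞) : ℝ≥0∞ :=
  E.nrm fun u => g (Real.exp (-u))

/-- The norm `‖g‖_{Ẽ(1,∞)} = ‖u ↦ g(e^{u})‖_{E(0,∞)}`. -/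
noncomputable def tildeNormOneTop (E : Parameter) (g : ℝ → ℝ≥0∞) : ℝ≥0∞ :=
  E.nrm fun u => g (Real.exp u)

/-- The norm of `Ẽ'(0,1)`, where `Ẽ'` is the associate space of `Ẽ` with respect to `dt/t`:
under `t = e^{-u}` this is the norm of the associate space `E'`. -/
noncomputable def tildeAssocNormZeroOne (E : Parameter) (h : ℝ → ℝ≥0∞) : ℝ≥0∞ :=
  E.assocNorm fun u => h (Real.exp (-u))

/-- `f` is equivalent on `(0, ∞)` to an increasing function. -/
def AlmostIncreasing (f : ℝ → ℝ) : Prop :=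
  ∃ g : ℝ → ℝ, MonotoneOn g (Ioi 0) ∧ ∃ C : ℝ, 0 < C ∧
    ∀ t, 0 < t → f t ≤ C * g t ∧ g t ≤ C * f t

/-- `f` is equivalent on `(0, ∞)` to a decreasing function. -/
def AlmostDecreasing (f : ℝ → ℝ) : Prop :=
  ∃ g : ℝ → ℝ, AntitoneOn g (Ioi 0) ∧ ∃ C : ℝ, 0 < C ∧
    ∀ t, 0 < t → f t ≤ C * g t ∧ g t ≤ C * f t

/-- Slowly varying functions on `(0, ∞)`. -/
structure SlowlyVarying (b : ℝ → ℝ) : Prop where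
  pos : ∀ t, 0 < t → 0 < b t
  measurable : AEMeasurable b (volume.restrict (Ioi (0 : ℝ)))
  almost_increasing : ∀ ε : ℝ, 0 < ε → AlmostIncreasing fun t => t ^ ε * b t
  almost_decreasing : ∀ ε : ℝ, 0 < ε → AlmostDecreasing fun t => t ^ (-ε) * b t

/-- The dilation function `M_φ(t) = sup_{s>0} φ(st)/φ(s)`. -/
noncomputable def dilationFunction (φ : ℝ → ℝ) (t : ℝ) : ℝ :=
  ⨆ s : Ioi (0 : ℝ), φ (s * t) / φ s

/-- `β` is the lower extension index of `φ`. -/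
def HasLowerIndex (φ : ℝ → ℝ) (β : ℝ) : Prop :=
  Tendsto (fun t => Real.log (dilationFunction φ t) / Real.log t) (𝓝[>] 0) (𝓝 β)

/-- `β` is the upper extension index of `φ`. -/
def HasUpperIndex (φ : ℝ → ℝ) (β : ℝ) : Prop :=
  Tendsto (fun t => Real.log (dilationFunction φ t) / Real.log t) atTop (𝓝 β)

section Besov

variable {Ω : Type*} [MetricSpace Ω] [MeasurableSpace Ω] {μ : Measure Ω}

/-- The `X`-modulus of continuity `E_X(f,t) = ‖ ⨍_{B(x,t)} |f(x) - f(y)| dμ(y) ‖_X`. -/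
noncomputable def modulus (X : RISpace μ) (f : Ω → ℝ) (t : ℝ) : ℝ≥0∞ :=
  X.nrm fun x => ⨍⁻ y in Metric.ball x t, ‖f x - f y‖ₑ ∂μ

/-- The function `t ↦ t^{-θ} b(t) E_X(f,t)`. -/
noncomputable def weightedModulus (X : RISpace μ) (θ : ℝ) (b : ℝ → ℝ) (f : Ω → ℝ) (t : ℝ) :
    ℝ≥0∞ :=
  ENNReal.ofReal (t ^ (-θ) * b t) * modulus X f t

/-- Membership in the homogeneous generalised Hajłasz–Besov space: `f ∈ L¹ + L^∞` and
`t^{-θ} b(t) E_X(f,t)` belongs to `Ẽ`, that is, to `Ẽ(0,1)` and to `Ẽ(1,∞)`. -/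
def MemHomBesov (X : RISpace μ) (E : Parameter) (θ : ℝ) (b : ℝ → ℝ) (f : Ω → ℝ) : Prop :=
  (∃ g h : Ω → ℝ, MemLp g 1 μ ∧ MemLp h ∞ μ ∧ f =ᵐ[μ] fun x => g x + h x) ∧
  tildeNormZeroOne E (weightedModulus X θ b f) < ∞ ∧
  tildeNormOneTop E (weightedModulus X θ b f) < ∞

/-- Membership in the inhomogeneous space: the intersection of the homogeneous space with `X`. -/
def MemBesov (X : RISpace μ) (E : Parameter) (θ : ℝ) (b : ℝ → ℝ) (f : Ω → ℝ) : Prop :=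
  MemHomBesov X E θ b f ∧ X.realNorm f < ∞

/-- The norm of the inhomogeneous space. -/
noncomputable def besovNorm (X : RISpace μ) (E : Parameter) (θ : ℝ) (b : ℝ → ℝ) (f : Ω → ℝ) :
    ℝ≥0∞ :=
  tildeNormZeroOne E (weightedModulus X θ b f) + X.realNorm f

/-- `f` coincides almost everywhere with a continuous function. -/
def EssentiallyContinuous (μ : Measure Ω) (f : Ω → ℝ) : Prop :=
  ∃ g : Ω → ℝ, Continuous g ∧ f =ᵐ[μ] g

end Besov

end HajlaszBesov

open HajlaszBesov

/-! Everything rests on a Chebyshev-type estimate. Let O(z) be the mean of |f(z) - f(w)| over w in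
B(z,4r). For every z in B(x,r), O(z) controls, up to a doubling constant, the distance from f(z) to
the mean of f over any ball of radius about r centred within r of x. Since ‖O‖_X = E_X(f,4r), some z
in B(x,r) has O(z) at most about E_X(f,4r)/‖χ_{B(x,r)}‖_X. Passing through f(z), neighbouring means
at scale r differ by at most a constant times this quotient (`exists_edist_average_average_le`).

If bounds for these quotients, uniform in x, are summable along a geometric sequence of radii, then
the means converge uniformly, Lebesgue differentiation identifies the limit with f almost
everywhere, and the tails of the series bound the oscillation of the limit
(`exists_representative_of_average_osc`). Non-collapsing supplies uniformity: μ(B(x,r)) ≥ c r^n for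
r ≤ 1, so the denominator is at least φ_X(c r^n).

For (i), the radii are taken with r^n comparable to e^{-k}. The series is then dominated by the
integral of t^{θ/n}/(b(t^{1/n}) φ_X(t)) against a step function built from the weighted modulus,
which is finite by duality between E and E' (`exists_tsum_modulus_div_ne_top`). The substitution t ↦
t^{1/n} is a dilation in u = -log t; its cost in E is found by comparing distribution functions
(`Parameter.nrm_step_le`).

For (ii), finiteness of the norm gives E_X(f,t) ≲ t^θ/b(t), while the decrease of φ_X(t)/t^γ gives
‖χ_{B(x,r)}‖_X ≳ r^{γn}. The quotient is ≲ r^{θ-γn}/b(r), whose dyadic sums are controlled by the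
first term because θ - γn > 0. This settles close points; for distant ones a uniform bound on the
representative suffices. -/

namespace HajlaszBesov

/-! ### Norms of indicators and the fundamental function -/

section RIBasics

variable {α : Type*} [MeasurableSpace α] {μ : Measure α}

theorem rearrangement_mono_of_distribution_le {f g : α → ℝ≥0∞}
    (h : ∀ t : ℝ≥0∞, μ {x | t < f x} ≤ μ {x | t < g x}) (s : ℝ) :
    rearrangement μ f s ≤ rearrangement μ g s :=
  sInf_le_sInf fun t ht => (h t).trans ht

/-- In an r.i. space the norm is monotone with respect to the distribution functions. -/
theorem RISpace.nrm_le_of_distribution_le (X : RISpace μ) {f g : α → ℝ≥0∞}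
    (hf : AEMeasurable f μ) (hg : AEMeasurable g μ)
    (h : ∀ t : ℝ≥0∞, μ {x | t < f x} ≤ μ {x | t < g x}) : X.nrm f ≤ X.nrm g :=
  X.rearrangement_invariant f g hf hg
    (Eventually.of_forall fun s => rearrangement_mono_of_distribution_le h s)

theorem RISpace.nrm_zero (X : RISpace μ) : X.nrm (fun _ => 0) = 0 :=
  (X.nrm_eq_zero_iff _ aemeasurable_const).2 (ae_eq_refl _)

theorem RISpace.nrm_sum_le (X : RISpace μ) {ι : Type*} (s : Finset ι) (f : ι → α → ℝ≥0∞)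
    (hf : ∀ i, AEMeasurable (f i) μ) :
    X.nrm (fun x => ∑ i ∈ s, f i x) ≤ ∑ i ∈ s, X.nrm (f i) := by
  classical
  induction s using Finset.induction_on with
  | empty => simp [X.nrm_zero]
  | insert a s ha ih =>
    simp only [Finset.sum_insert ha]
    exact (X.nrm_add_le _ _ (hf a) (Finset.aemeasurable_fun_sum s fun i _ => hf i)).trans
      (by gcongr)

theorem aemeasurable_indicator_one {A : Set α} (hA : MeasurableSet A) :
    AEMeasurable (A.indicator fun _ => (1 : ℝ≥0∞)) μ :=
  (measurable_const.indicator hA).aemeasurable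

theorem RISpace.nrm_indicator_mono (X : RISpace μ) {A B : Set α} (hA : MeasurableSet A)
    (hB : MeasurableSet B) (h : μ A ≤ μ B) :
    X.nrm (A.indicator fun _ => 1) ≤ X.nrm (B.indicator fun _ => 1) := by
  have key : ∀ (S : Set α) (t : ℝ≥0∞),
      {x | t < S.indicator (fun _ => (1 : ℝ≥0∞)) x} = if t < 1 then S else ∅ := by
    intro S t
    ext x
    by_cases hx : x ∈ S <;> by_cases ht : t < 1 <;> simp [hx, ht]
  refine X.nrm_le_of_distribution_le (aemeasurable_indicator_one hA)
    (aemeasurable_indicator_one hB) fun t => ?_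
  rw [key, key]
  split_ifs <;> simp [h]

theorem RISpace.nrm_indicator_ne_zero (X : RISpace μ) {A : Set α} (hA : MeasurableSet A)
    (h : μ A ≠ 0) : X.nrm (A.indicator fun _ => 1) ≠ 0 := by
  intro h0
  rw [X.nrm_eq_zero_iff _ (aemeasurable_indicator_one hA)] at h0
  have := indicator_ae_eq_zero.1 h0
  simp [Function.support] at this
  exact h this

theorem RISpace.ofReal_fundamental (X : RISpace μ) {A : Set α} (hA : MeasurableSet A) {t : ℝ}
    (h : μ A = ENNReal.ofReal t) :
    ENNReal.ofReal (X.fundamental t) = X.nrm (A.indicator fun _ => 1) := by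
  have : (⨆ (F : Set α) (_ : MeasurableSet F) (_ : μ F = ENNReal.ofReal t),
      X.nrm (F.indicator fun _ => 1)) = X.nrm (A.indicator fun _ => 1) :=
    le_antisymm (iSup_le fun F => iSup_le fun hF => iSup_le fun hFt =>
      X.nrm_indicator_mono hF hA (by rw [hFt, h]))
      (le_iSup_of_le A (le_iSup_of_le hA (le_iSup_of_le h le_rfl)))
  rw [RISpace.fundamental, this, ENNReal.ofReal_toReal]
  exact (X.nrm_indicator_lt_top A hA (by simp [h])).ne

/-- If `g > c` on `A` then `c ‖χ_A‖ ≤ ‖g‖`; contrapositively, `g` is at most `c` somewhere on `A`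
as soon as `‖g‖ < c ‖χ_A‖`. -/
theorem RISpace.exists_le_of_nrm_lt (X : RISpace μ) {A : Set α} (hA : MeasurableSet A)
    {g : α → ℝ≥0∞} (hg : AEMeasurable g μ) {c : ℝ≥0}
    (h : X.nrm g < c * X.nrm (A.indicator fun _ => 1)) : ∃ z ∈ A, g z ≤ c := by
  by_contra! hc
  refine absurd h (not_lt.2 ?_)
  rw [← X.nrm_const_mul c _ (aemeasurable_indicator_one hA)]
  refine X.nrm_mono _ _ ((aemeasurable_indicator_one hA).const_mul _) hg
    (Eventually.of_forall fun x => ?_)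
  by_cases hx : x ∈ A
  · simpa [hx] using (hc x hx).le
  · simp [hx]

end RIBasics

/-! ### Intermediate values of atomless measures -/

section Intermediate

/-- Without point masses the distribution function is continuous, being a primitive of 1, and it
runs from 0 to the total mass. -/
theorem exists_measure_Iic_eq (ν : Measure ℝ) [IsFiniteMeasure ν] [NullSingletonClass ν] {s : ℝ}
    (hs : 0 < s) (hs' : s < ν.real univ) : ∃ t, ν.real (Iic t) = s := by
  have hcont : Continuous fun t => ν.real (Iic t) := by
    have h1 : ∀ a b : ℝ, IntervalIntegrable (fun _ => (1 : ℝ)) ν a b := fun a b => by simp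
    have h2 := intervalIntegral.continuous_primitive h1 0
    have h3 : (fun t => ν.real (Iic t)) =
        fun t => (∫ _ in (0 : ℝ)..t, (1 : ℝ) ∂ν) + ν.real (Iic 0) := by
      funext t
      rw [← intervalIntegral.integral_Iic_sub_Iic (by simp [IntegrableOn])
        (by simp [IntegrableOn])]
      simp
    rw [h3]
    exact h2.add continuous_const
  have htop : Tendsto (fun t => ν.real (Iic t)) atTop (𝓝 (ν.real univ)) :=
    (ENNReal.tendsto_toReal (measure_ne_top _ _)).comp (tendsto_measure_Iic_atTop ν)
  have hbot : Tendsto (fun t => ν.real (Iic t)) atBot (𝓝 0) := by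
    have h1 := (ENNReal.tendsto_toReal (measure_ne_top ν univ)).comp (tendsto_measure_Ici_atBot ν)
    have h2 : (fun t => ν.real (Iic t)) = fun t => ν.real univ - ν.real (Ici t) := by
      funext t
      rw [← measureReal_compl measurableSet_Ici, compl_Ici]
      exact congrArg ENNReal.toReal (measure_congr Iio_ae_eq_Iic.symm)
    rw [h2, ← sub_self (ν.real univ)]
    exact h1.const_sub _
  obtain ⟨b, hb⟩ := (htop.eventually (lt_mem_nhds hs')).exists
  obtain ⟨a, ha⟩ := (hbot.eventually (gt_mem_nhds hs)).exists
  exact mem_range_of_exists_le_of_exists_ge hcont ⟨a, ha.le⟩ ⟨b, hb.le⟩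

/-- Sierpiński's theorem for measures without atoms on a countably separated space. -/
theorem exists_measure_eq_of_noAtoms {α : Type*} [MeasurableSpace α]
    [MeasurableSpace.CountablySeparated α] (μ : Measure α) (hμ : ∀ x, μ {x} = 0)
    {A : Set α} (hA : MeasurableSet A) (hfin : μ A ≠ ∞) {s : ℝ} (hs : 0 < s)
    (hsA : ENNReal.ofReal s < μ A) :
    ∃ F, MeasurableSet F ∧ μ F = ENNReal.ofReal s := by
  -- A measurable injection into ℝ transports the problem to the line; injectivity keeps the image
  -- measure free of atoms.
  obtain ⟨i, hi, hinj⟩ := MeasurableSpace.measurable_injection_nat_bool_of_countablySeparated α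
  have he := measurableEmbedding_embeddingReal (ℕ → Bool)
  set j : α → ℝ := embeddingReal (ℕ → Bool) ∘ i
  have hj : Measurable j := he.measurable.comp hi
  have hjinj : Function.Injective j := he.injective.comp hinj
  have : Fact (μ A < ∞) := ⟨hfin.lt_top⟩
  let ν := (μ.restrict A).map j
  have : IsFiniteMeasure ν := inferInstance
  have : NullSingletonClass ν := ⟨fun x => by
    rw [Measure.map_apply hj (measurableSet_singleton x)]
    have hsub : (j ⁻¹' {x}).Subsingleton := fun a ha b hb =>
      hjinj ((mem_singleton_iff.1 ha).trans (mem_singleton_iff.1 hb).symm)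
    refine Measure.absolutelyContinuous_of_le Measure.restrict_le_self ?_
    rcases hsub.eq_empty_or_singleton with h0 | ⟨a, h0⟩ <;> rw [h0]
    · exact measure_empty
    · exact hμ a⟩
  obtain ⟨t, ht⟩ := exists_measure_Iic_eq ν hs (by
    rw [Measure.real, Measure.map_apply hj MeasurableSet.univ]
    simp only [preimage_univ, Measure.restrict_apply_univ]
    rwa [← ENNReal.ofReal_lt_iff_lt_toReal hs.le hfin])
  refine ⟨j ⁻¹' Iic t ∩ A, (hj measurableSet_Iic).inter hA, ?_⟩
  rw [← ht, Measure.real, ENNReal.ofReal_toReal (measure_ne_top _ _),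
    Measure.map_apply hj measurableSet_Iic, Measure.restrict_apply (hj measurableSet_Iic)]

end Intermediate

/-! ### Geometry of RD-spaces -/

section Geometry

variable {Ω : Type*} [MetricSpace Ω] [MeasurableSpace Ω] {μ : Measure Ω} {k n : ℝ}

theorem IsRDSpace.n_pos (h : IsRDSpace μ k n) : 0 < n := h.lower_pos.trans_le h.lower_le_upper

theorem IsRDSpace.exists_doubling (h : IsRDSpace μ k n) :
    ∃ K : ℝ, 1 ≤ K ∧ ∀ (x : Ω) (r l : ℝ), 0 < r → 1 ≤ l →
      μ (Metric.ball x (l * r)) ≤ ENNReal.ofReal (K * l ^ n) * μ (Metric.ball x r) := by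
  obtain ⟨_, K, _, _, hK, hg⟩ := h.growth
  exact ⟨K, hK, fun x r l hr hl => (hg x r l hr hl).2⟩

theorem IsRDSpace.sigmaFinite (h : IsRDSpace μ k n) : SigmaFinite μ := by
  rcases isEmpty_or_nonempty Ω with he | ⟨⟨x⟩⟩
  · rw [Measure.eq_zero_of_isEmpty μ]; infer_instance
  · refine ⟨⟨⟨fun i : ℕ => Metric.ball x (i + 1), fun _ => trivial,
      fun i => h.ball_lt_top x _ (by positivity), ?_⟩⟩⟩
    refine eq_univ_of_forall fun y => mem_iUnion.2 ?_
    obtain ⟨i, hi⟩ := exists_nat_gt (dist y x)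
    exact ⟨i, Metric.mem_ball.2 (hi.trans (lt_add_one _))⟩

theorem IsRDSpace.isLocallyFinite (h : IsRDSpace μ k n) : IsLocallyFiniteMeasure μ :=
  ⟨fun x => ⟨Metric.ball x 1, Metric.ball_mem_nhds x one_pos, h.ball_lt_top x 1 one_pos⟩⟩

theorem IsRDSpace.isUnifLocDoubling (h : IsRDSpace μ k n) : IsUnifLocDoublingMeasure μ := by
  obtain ⟨K, hK, hg⟩ := h.exists_doubling
  refine ⟨⟨(K * 3 ^ n).toNNReal, ?_⟩⟩
  filter_upwards [self_mem_nhdsWithin] with ε hε x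
  have hε : 0 < ε := hε
  calc μ (Metric.closedBall x (2 * ε)) ≤ μ (Metric.ball x (3 * ε)) :=
        measure_mono (Metric.closedBall_subset_ball (by linarith))
    _ ≤ ENNReal.ofReal (K * 3 ^ n) * μ (Metric.ball x ε) := hg x ε 3 hε (by norm_num)
    _ ≤ _ := by
        rw [ENNReal.ofReal]
        gcongr
        exact Metric.ball_subset_closedBall

/-- The reverse doubling exponent `k` is positive, so balls about a point have unbounded measure.
Hence every s > 0 is the measure of some set, and φ_X(s) is never a supremum over the empty family.
-/
theorem IsRDSpace.exists_ball_measure_gt (h : IsRDSpace μ k n) (x : Ω) (s : ℝ) :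
    ∃ r, 0 < r ∧ ENNReal.ofReal s < μ (Metric.ball x r) := by
  obtain ⟨C, _, hC, _, _, hg⟩ := h.growth
  have hm := h.ball_pos x 1 one_pos
  have hm' := h.ball_lt_top x 1 one_pos
  set m := (μ (Metric.ball x 1)).toReal
  have hm0 : 0 < m := ENNReal.toReal_pos hm.ne' hm'.ne
  have ht := (tendsto_rpow_atTop h.lower_pos).eventually_gt_atTop (s / (C * m))
  obtain ⟨l, hl, hl1⟩ := (ht.and (eventually_ge_atTop 1)).exists
  refine ⟨l, by linarith, lt_of_lt_of_le ?_ (by simpa using (hg x 1 l one_pos hl1).1)⟩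
  rw [← ENNReal.ofReal_toReal hm'.ne, ← ENNReal.ofReal_mul (by positivity)]
  refine (ENNReal.ofReal_lt_ofReal_iff (by positivity)).2 ?_
  rw [div_lt_iff₀ (by positivity)] at hl
  change s < C * l ^ k * m
  linarith

/-- Doubling from radius r up to radius 1 costs a factor K r^{-n}, while the unit ball has measure
bounded below. -/
theorem IsRDSpace.exists_ball_lower (h : IsRDSpace μ k n) (hnc : IsNonCollapsing μ) :
    ∃ c : ℝ, 0 < c ∧ ∀ (x : Ω) (r : ℝ), 0 < r → r ≤ 1 →
      ENNReal.ofReal (c * r ^ n) ≤ μ (Metric.ball x r) := by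
  obtain ⟨K, hK, hg⟩ := h.exists_doubling
  obtain ⟨m, hm0, hm⟩ := ENNReal.lt_iff_exists_nnreal_btwn.1 hnc
  have hm0 : 0 < (m : ℝ) := by exact_mod_cast hm0
  refine ⟨m / K, by positivity, fun x r hr hr1 => ?_⟩
  have h1 : ENNReal.ofReal m ≤ μ (Metric.ball x 1) := by
    rw [ENNReal.ofReal_coe_nnreal]
    exact hm.le.trans (iInf_le _ x)
  have h2 := hg x r (1 / r) hr (by rwa [le_div_iff₀ hr, one_mul])
  rw [one_div_mul_cancel hr.ne'] at h2
  have h3 := h1.trans h2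
  have hfin := (h.ball_lt_top x r hr).ne
  rw [← ENNReal.ofReal_toReal hfin] at h3 ⊢
  rw [← ENNReal.ofReal_mul (by positivity)] at h3
  have h4 := (ENNReal.ofReal_le_ofReal_iff (by positivity)).1 h3
  refine ENNReal.ofReal_le_ofReal ?_
  rw [one_div, Real.inv_rpow hr.le] at h4
  have hrn : 0 < r ^ n := Real.rpow_pos_of_pos hr n
  field_simp at h4 ⊢
  linarith

variable [BorelSpace Ω]

/-- The balls of radius ε/2 about the points of an ε-separated set are disjoint and of positive
measure, so σ-finiteness makes such a set countable; a maximal one is an ε-net. -/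
theorem IsRDSpace.secondCountable (h : IsRDSpace μ k n) : SecondCountableTopology Ω := by
  have := h.sigmaFinite
  refine Metric.secondCountable_of_almost_dense_set fun ε hε => ?_
  obtain ⟨S, -, hS⟩ := zorn_subset_nonempty
    {S : Set Ω | S.Pairwise fun x y => ε < dist x y} (by
      intro c hc hchain _
      refine ⟨⋃₀ c, ?_, fun s hs => subset_sUnion_of_mem hs⟩
      exact (pairwise_sUnion hchain.directedOn).2 fun s hs => hc hs) ∅ (by simp)
  refine ⟨S, ?_, fun x => ?_⟩
  · have hc := Measure.countable_meas_pos_of_disjoint_iUnion (μ := μ)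
      (As := fun x : S => Metric.ball (x : Ω) (ε / 2)) (fun _ => measurableSet_ball) (by
        intro x y hxy
        refine Metric.ball_disjoint_ball ?_
        have := hS.prop x.2 y.2 (fun hh => hxy (Subtype.ext hh))
        linarith)
    have : {i : S | 0 < μ (Metric.ball (i : Ω) (ε / 2))} = univ :=
      eq_univ_of_forall fun i => h.ball_pos _ _ (by positivity)
    rw [this, countable_univ_iff] at hc
    exact hc
  · by_contra! hx
    have hins : insert x S ∈ {S : Set Ω | S.Pairwise fun x y => ε < dist x y} := by
      refine hS.prop.insert fun y hy _ => ⟨hx y hy, ?_⟩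
      rw [dist_comm]; exact hx y hy
    have := hS.le_of_ge hins (subset_insert x S) (mem_insert x S)
    exact absurd (hx x this) (by simpa using hε.le)

theorem IsRDSpace.exists_measure_eq (h : IsRDSpace μ k n) [Nonempty Ω] {s : ℝ} (hs : 0 < s) :
    ∃ F, MeasurableSet F ∧ μ F = ENNReal.ofReal s := by
  have := h.secondCountable
  obtain ⟨r, hr, hrs⟩ := h.exists_ball_measure_gt (Classical.arbitrary Ω) s
  exact exists_measure_eq_of_noAtoms μ h.atom_free measurableSet_ball
    (h.ball_lt_top _ r hr).ne hs hrs

theorem RISpace.fundamental_pos (h : IsRDSpace μ k n) [Nonempty Ω] (X : RISpace μ) {s : ℝ}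
    (hs : 0 < s) : 0 < X.fundamental s := by
  obtain ⟨F, hF, hFs⟩ := h.exists_measure_eq hs
  have := X.nrm_indicator_ne_zero hF (by rw [hFs]; simpa using hs)
  rw [← X.ofReal_fundamental hF hFs] at this
  simpa using this

theorem RISpace.ofReal_fundamental_le (h : IsRDSpace μ k n) [Nonempty Ω] (X : RISpace μ) {s : ℝ}
    (hs : 0 < s) {A : Set Ω} (hA : MeasurableSet A) (hsA : ENNReal.ofReal s ≤ μ A) :
    ENNReal.ofReal (X.fundamental s) ≤ X.nrm (A.indicator fun _ => 1) := by
  obtain ⟨F, hF, hFs⟩ := h.exists_measure_eq hs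
  rw [X.ofReal_fundamental hF hFs]
  exact X.nrm_indicator_mono hF hA (by rwa [hFs])

theorem RISpace.fundamental_mono (h : IsRDSpace μ k n) [Nonempty Ω] (X : RISpace μ) {s t : ℝ}
    (hs : 0 < s) (hst : s ≤ t) : X.fundamental s ≤ X.fundamental t := by
  obtain ⟨F, hF, hFt⟩ := h.exists_measure_eq (hs.trans_le hst)
  have := X.ofReal_fundamental_le h hs hF (by rw [hFt]; exact ENNReal.ofReal_le_ofReal hst)
  rw [← X.ofReal_fundamental hF hFt] at this
  exact (ENNReal.ofReal_le_ofReal_iff (X.fundamental_pos h (hs.trans_le hst)).le).1 this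

end Geometry

/-! ### A Borel criterion on the line -/

section LeftOpen

/-- A set that contains with each point an interval to the left of it is a Borel set. -/
theorem measurableSet_of_forall_exists_Ioc_subset {S : Set ℝ}
    (h : ∀ t ∈ S, ∃ s < t, Ioc s t ⊆ S) : MeasurableSet S := by
  have hU : IsOpen (interior S) := isOpen_interior
  -- The interval to the left of a point of S has its interior inside `interior S`, so the points of
  -- `S \ interior S` are isolated from the left, and there are only countably many such points.
  have hc : (S \ interior S).Countable := by
    refine (countable_setOfPred_isolated_left_within (s := S \ interior S)).mono ?_
    intro t ht
    refine ⟨ht, ?_⟩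
    obtain ⟨s, hst, hs⟩ := h t ht.1
    rw [← empty_mem_iff_bot, mem_nhdsWithin]
    refine ⟨Ioi s, isOpen_Ioi, hst, fun r hr => ?_⟩
    refine hr.2.1.2 (mem_interior.2 ⟨Ioo s t, fun x hx => hs ⟨hx.1, hx.2.le⟩, isOpen_Ioo, ?_⟩)
    exact ⟨hr.1, hr.2.2⟩
  rw [← sdiff_union_of_subset (interior_subset (s := S))]
  exact hc.measurableSet.union hU.measurableSet

end LeftOpen

/-! ### Comparison of averages -/

section Averages

variable {α : Type*} [MeasurableSpace α] {μ : Measure α}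

theorem setLAverage_le_mul_setLAverage {A B : Set α} (hAB : A ⊆ B) {C : ℝ≥0∞}
    (h : μ B ≤ C * μ A) (hA : μ A ≠ 0) (hB : μ B ≠ ∞) (F : α → ℝ≥0∞) :
    ⨍⁻ x in A, F x ∂μ ≤ C * ⨍⁻ x in B, F x ∂μ := by
  have hA' : μ A ≠ ∞ := measure_ne_top_of_subset hAB hB
  have hB' : μ B ≠ 0 := fun h0 => hA (measure_mono_null hAB h0)
  have key : (μ A)⁻¹ ≤ C * (μ B)⁻¹ := by
    rw [← div_eq_mul_inv, ENNReal.le_div_iff_mul_le (Or.inl hB') (Or.inl hB), mul_comm,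
      ← div_eq_mul_inv]
    exact ENNReal.div_le_of_le_mul h
  rw [setLAverage_eq, setLAverage_eq, div_eq_mul_inv, div_eq_mul_inv]
  calc (∫⁻ x in A, F x ∂μ) * (μ A)⁻¹ ≤ (∫⁻ x in B, F x ∂μ) * (C * (μ B)⁻¹) := by
        gcongr
    _ = _ := by ring

theorem edist_setAverage_le {f : α → ℝ} {S : Set α} (hf : IntegrableOn f S μ) (hS : μ S ≠ 0)
    (hS' : μ S ≠ ∞) (a : ℝ) :
    edist a (⨍ x in S, f x ∂μ) ≤ ⨍⁻ x in S, ‖a - f x‖ₑ ∂μ := by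
  have : Fact (μ S < ∞) := ⟨hS'.lt_top⟩
  have : NeZero (μ.restrict S) := ⟨by rwa [Ne, Measure.restrict_eq_zero]⟩
  have hf' : Integrable f ((μ.restrict S univ)⁻¹ • μ.restrict S) := Integrable.to_average hf
  rw [edist_eq_enorm_sub]
  have : a - ⨍ x in S, f x ∂μ = ∫ x, (a - f x) ∂((μ.restrict S univ)⁻¹ • μ.restrict S) := by
    rw [integral_sub (integrable_const _) hf']
    simp only [integral_const, probReal_univ, one_smul, average]
  rw [this]
  exact enorm_integral_le_lintegral_enorm _

end Averages

/-! ### The modulus of continuity and oscillation of averages -/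

section Modulus

variable {Ω : Type*} [MetricSpace Ω] [MeasurableSpace Ω] {μ : Measure Ω} {k n : ℝ}

theorem exists_edist_average_le (h : IsRDSpace μ k n) {L : ℝ} (hL : 1 ≤ L) :
    ∃ C : ℝ≥0, ∀ (f : Ω → ℝ), (∀ x r, IntegrableOn f (Metric.ball x r) μ) →
      ∀ (x y z : Ω) (r s : ℝ), 0 < r → r ≤ L * s → s ≤ r → dist y x ≤ r → z ∈ Metric.ball x r →
        edist (f z) (⨍ w in Metric.closedBall y s, f w ∂μ) ≤
          C * ⨍⁻ w in Metric.ball z (4 * r), ‖f z - f w‖ₑ ∂μ := by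
  obtain ⟨K, hK, hg⟩ := h.exists_doubling
  -- The inclusions are closedBall(y,s) ⊆ B(z,4r) ⊆ B(y,6r) ⊆ B(y,6Ls), since d(y,z) < 2r; doubling
  -- compares the outer ball with the inner one.
  refine ⟨(K * (6 * L) ^ n).toNNReal, fun f hf x y z r s hr hrs hsr hyx hz => ?_⟩
  have hs : 0 < s := by
    by_contra! hs
    nlinarith
  have hz : dist z x < r := hz
  have hsub : Metric.closedBall y s ⊆ Metric.ball z (4 * r) := by
    refine Metric.closedBall_subset_ball' ?_
    have := dist_triangle_right y z x
    linarith
  have hsub' : Metric.ball z (4 * r) ⊆ Metric.ball y ((6 * L) * s) := by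
    refine Metric.ball_subset_ball' ?_
    have := dist_triangle_right z y x
    nlinarith
  have h0 : μ (Metric.closedBall y s) ≠ 0 :=
    ((h.ball_pos y s hs).trans_le (measure_mono Metric.ball_subset_closedBall)).ne'
  have h1 : μ (Metric.ball z (4 * r)) ≠ ∞ := (h.ball_lt_top z _ (by positivity)).ne
  refine (edist_setAverage_le ((hf z (4 * r)).mono_set hsub) h0
    (measure_ne_top_of_subset hsub h1) (f z)).trans ?_
  refine setLAverage_le_mul_setLAverage hsub ?_ h0 h1 _
  calc μ (Metric.ball z (4 * r)) ≤ μ (Metric.ball y ((6 * L) * s)) := measure_mono hsub'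
    _ ≤ ENNReal.ofReal (K * (6 * L) ^ n) * μ (Metric.ball y s) := hg y s _ hs (by linarith)
    _ ≤ _ := by
        rw [ENNReal.ofReal]
        gcongr
        exact Metric.ball_subset_closedBall

variable [BorelSpace Ω]

theorem IsRDSpace.aemeasurable_setLIntegral_ball (h : IsRDSpace μ k n) {f : Ω → ℝ}
    (hf : AEMeasurable f μ) (s : ℝ) :
    AEMeasurable (fun x => ∫⁻ y in Metric.ball x s, ‖f x - f y‖ₑ ∂μ) μ := by
  have := h.secondCountable
  have := h.sigmaFinite
  have hD : MeasurableSet {p : Ω × Ω | dist p.2 p.1 < s} :=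
    measurableSet_lt (measurable_snd.dist measurable_fst) measurable_const
  have hm : Measurable fun p : Ω × Ω => {p : Ω × Ω | dist p.2 p.1 < s}.indicator
      (fun p => ‖hf.mk f p.1 - hf.mk f p.2‖ₑ) p :=
    (((hf.measurable_mk.comp measurable_fst).sub
      (hf.measurable_mk.comp measurable_snd)).enorm).indicator hD
  refine ⟨_, hm.lintegral_prod_right' (ν := μ), ?_⟩
  filter_upwards [hf.ae_eq_mk] with x hx
  rw [← lintegral_indicator measurableSet_ball]
  refine lintegral_congr_ae ?_
  filter_upwards [hf.ae_eq_mk] with y hy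
  simp only [indicator, Metric.mem_ball, mem_ofPred_eq, hx, hy]

theorem IsRDSpace.measurable_measure_ball (h : IsRDSpace μ k n) (s : ℝ) :
    Measurable fun x => μ (Metric.ball x s) := by
  have := h.secondCountable
  have := h.sigmaFinite
  exact measurable_measure_prodMk_left (ν := μ) (s := {p : Ω × Ω | dist p.2 p.1 < s})
    (measurableSet_lt (measurable_snd.dist measurable_fst) measurable_const)

theorem IsRDSpace.aemeasurable_laverage_ball (h : IsRDSpace μ k n) {f : Ω → ℝ}
    (hf : AEMeasurable f μ) (t : ℝ) :
    AEMeasurable (fun x => ⨍⁻ y in Metric.ball x t, ‖f x - f y‖ₑ ∂μ) μ := by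
  simp only [setLAverage_eq]
  exact (h.aemeasurable_setLIntegral_ball hf t).div (h.measurable_measure_ball t).aemeasurable

/-- Open balls of radii σ_i ↑ t exhaust B(x,t). With the denominator frozen at μ(B(x,t)), the Fatou
property makes the norms increase to E_X(f,t). For r in (σ_i,t] the true average has a larger
numerator and a smaller denominator, so it inherits the lower bound. -/
theorem modulus_left_lowerSemicontinuous (h : IsRDSpace μ k n) (X : RISpace μ) {f : Ω → ℝ}
    (hf : AEMeasurable f μ) {t : ℝ} {a : ℝ≥0∞} (ha : a < modulus X f t) :
    ∃ s < t, Ioc s t ⊆ {r | a < modulus X f r} := by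
  obtain ⟨σ, hσ, hσt, hσl⟩ := exists_seq_strictMono_tendsto t
  have hball : ∀ x : Ω, Metric.ball x t = ⋃ i, Metric.ball x (σ i) := by
    intro x
    ext y
    simp only [Metric.mem_ball, mem_iUnion]
    exact ⟨fun hy => (hσl.eventually (lt_mem_nhds hy)).exists, fun ⟨i, hi⟩ => hi.trans (hσt i)⟩
  have hmono : ∀ x : Ω, Monotone fun i => Metric.ball x (σ i) :=
    fun x i j hij => Metric.ball_subset_ball (hσ.monotone hij)
  let u : ℕ → Ω → ℝ≥0∞ := fun i x =>
    (∫⁻ y in Metric.ball x (σ i), ‖f x - f y‖ₑ ∂μ) / μ (Metric.ball x t)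
  have hu : ∀ i, AEMeasurable (u i) μ := fun i =>
    (h.aemeasurable_setLIntegral_ball hf _).div (h.measurable_measure_ball t).aemeasurable
  have hum : Monotone u := fun i j hij x =>
    ENNReal.div_le_div_right (lintegral_mono_set (hmono x hij)) _
  have hsup : modulus X f t = ⨆ i, X.nrm (u i) := by
    rw [← X.fatou u hu hum, modulus]
    congr 1
    funext x
    simp only [u, setLAverage_eq, div_eq_mul_inv]
    rw [← ENNReal.iSup_mul, hball x,
      setLIntegral_iUnion_of_directed _ (hmono x).directed_le]
  rw [hsup, lt_iSup_iff] at ha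
  obtain ⟨i, hi⟩ := ha
  refine ⟨σ i, hσt i, fun r hr => hi.trans_le ?_⟩
  refine X.nrm_mono _ _ (hu i) (h.aemeasurable_laverage_ball hf r)
    (Eventually.of_forall fun x => ?_)
  simp only [u, setLAverage_eq]
  exact ENNReal.div_le_div (lintegral_mono_set (Metric.ball_subset_ball hr.1.le))
    (measure_mono (Metric.ball_subset_ball hr.2))

theorem measurable_modulus (h : IsRDSpace μ k n) (X : RISpace μ) {f : Ω → ℝ}
    (hf : AEMeasurable f μ) : Measurable (modulus X f) :=
  measurable_of_Ioi fun _ => measurableSet_of_forall_exists_Ioc_subset fun _ ht =>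
    modulus_left_lowerSemicontinuous h X hf ht

/-- The normalised modulus need not be monotone in t, but doubling makes it almost so over a bounded
range of scales. -/
theorem exists_modulus_le (h : IsRDSpace μ k n) {L : ℝ} (hL : 1 ≤ L) :
    ∃ C : ℝ≥0, ∀ (X : RISpace μ) (f : Ω → ℝ), AEMeasurable f μ → ∀ s t : ℝ, 0 < s → s ≤ t →
      t ≤ L * s → modulus X f s ≤ C * modulus X f t := by
  obtain ⟨K, hK, hg⟩ := h.exists_doubling
  refine ⟨(K * L ^ n).toNNReal, fun X f hf s t hs hst htL => ?_⟩
  have hm := h.aemeasurable_laverage_ball hf t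
  rw [modulus, modulus, ← X.nrm_const_mul _ _ hm]
  refine X.nrm_mono _ _ (h.aemeasurable_laverage_ball hf s) (hm.const_mul _)
    (Eventually.of_forall fun x => ?_)
  exact setLAverage_le_mul_setLAverage (Metric.ball_subset_ball hst)
    ((measure_mono (Metric.ball_subset_ball htL)).trans (hg x s L hs hL))
    (h.ball_pos x s hs).ne' (h.ball_lt_top x t (hs.trans_le hst)).ne _

theorem IsRDSpace.nrm_ball_ne_zero (h : IsRDSpace μ k n) (X : RISpace μ) (x : Ω) {r : ℝ}
    (hr : 0 < r) : X.nrm ((Metric.ball x r).indicator fun _ => 1) ≠ 0 :=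
  X.nrm_indicator_ne_zero measurableSet_ball (h.ball_pos x r hr).ne'

theorem IsRDSpace.nrm_ball_ne_top (h : IsRDSpace μ k n) (X : RISpace μ) (x : Ω) {r : ℝ}
    (hr : 0 < r) : X.nrm ((Metric.ball x r).indicator fun _ => 1) ≠ ∞ :=
  (X.nrm_indicator_lt_top _ measurableSet_ball (h.ball_lt_top x r hr)).ne

theorem RISpace.exists_mem_ball_le (h : IsRDSpace μ k n) (X : RISpace μ) {g : Ω → ℝ≥0∞}
    (hg : AEMeasurable g μ) (x : Ω) {r : ℝ} (hr : 0 < r) {c : ℝ≥0}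
    (hc : X.nrm g / X.nrm ((Metric.ball x r).indicator fun _ => 1) < c) :
    ∃ z ∈ Metric.ball x r, g z ≤ c :=
  X.exists_le_of_nrm_lt measurableSet_ball hg
    ((ENNReal.div_lt_iff (Or.inl (h.nrm_ball_ne_zero X x hr))
      (Or.inl (h.nrm_ball_ne_top X x hr))).1 hc)

/-- The Chebyshev argument yields a point only for a constant strictly above the quotient of norms;
this removes the slack, also when the quotient is infinite. -/
theorem le_mul_of_forall_nnreal_lt {a b : ℝ≥0∞} {C : ℝ≥0} (hC : C ≠ 0)
    (h : ∀ c : ℝ≥0, b < c → a ≤ C * c) : a ≤ C * b := by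
  have hC' : (C : ℝ≥0∞) ≠ 0 := by exact_mod_cast hC
  rw [← ENNReal.div_le_iff' hC' ENNReal.coe_ne_top]
  refine le_of_forall_gt_imp_ge_of_dense fun c hc => ?_
  obtain ⟨c', hc', hc''⟩ := ENNReal.lt_iff_exists_nnreal_btwn.1 hc
  exact ((ENNReal.div_le_iff' hC' ENNReal.coe_ne_top).2 (h c' hc')).trans hc''.le

theorem exists_edist_average_average_le (h : IsRDSpace μ k n) {L : ℝ} (hL : 1 ≤ L) :
    ∃ C : ℝ≥0, ∀ (X : RISpace μ) (f : Ω → ℝ), AEMeasurable f μ →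
      (∀ x r, IntegrableOn f (Metric.ball x r) μ) →
      ∀ (x y : Ω) (r s s' : ℝ), 0 < r → r ≤ L * s → s ≤ r → r ≤ L * s' → s' ≤ r → dist x y ≤ r →
        edist (⨍ w in Metric.closedBall x s, f w ∂μ) (⨍ w in Metric.closedBall y s', f w ∂μ) ≤
          C * (modulus X f (4 * r) / X.nrm ((Metric.ball x r).indicator fun _ => 1)) := by
  obtain ⟨C, hC⟩ := exists_edist_average_le h hL
  -- One C for each of the two means compared with f(z); the 1 only keeps the constant nonzero.
  refine ⟨C + C + 1, fun X f hfm hf x y r s s' hr hs hs1 hs' hs1' hxy => ?_⟩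
  refine le_mul_of_forall_nnreal_lt (by positivity) fun c hc => ?_
  obtain ⟨z, hz, hzc⟩ := X.exists_mem_ball_le h (h.aemeasurable_laverage_ball hfm (4 * r)) x hr hc
  refine (edist_triangle_left _ _ (f z)).trans ?_
  push_cast
  rw [add_mul, add_mul]
  refine le_trans (add_le_add ?_ ?_) le_self_add
  exacts [
    ((hC f hf x x z r s hr hs hs1 (by simpa using hr.le) hz).trans (by gcongr)),
    ((hC f hf x y z r s' hr hs' hs1' (by rwa [dist_comm]) hz).trans (by gcongr))]

/-- The same argument applied to |f| plus its local oscillation: at one point z of the ball both are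
small together, and |f(z)| then bounds the mean. -/
theorem exists_enorm_average_le (h : IsRDSpace μ k n) :
    ∃ C : ℝ≥0, ∀ (X : RISpace μ) (f : Ω → ℝ), AEMeasurable f μ →
      (∀ x r, IntegrableOn f (Metric.ball x r) μ) → ∀ (x : Ω) (r : ℝ), 0 < r →
        ‖⨍ w in Metric.closedBall x r, f w ∂μ‖ₑ ≤
          C * ((X.realNorm f + modulus X f (4 * r)) /
            X.nrm ((Metric.ball x r).indicator fun _ => 1)) := by
  obtain ⟨C, hC⟩ := exists_edist_average_le h le_rfl
  refine ⟨C + 1, fun X f hfm hf x r hr => ?_⟩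
  refine le_mul_of_forall_nnreal_lt (by positivity) fun c hc => ?_
  have hm := h.aemeasurable_laverage_ball hfm (4 * r)
  obtain ⟨z, hz, hzc⟩ := X.exists_mem_ball_le h (hfm.enorm.add hm) x hr
    (lt_of_le_of_lt (ENNReal.div_le_div_right (X.nrm_add_le _ _ hfm.enorm hm) _) hc)
  have h1 := (hC f hf x x z r r hr (by simp) le_rfl (by simpa using hr.le) hz).trans
    (mul_le_mul_right (le_trans le_add_self hzc) _)
  have h2 : ‖f z‖ₑ ≤ c := le_trans le_self_add hzc
  rw [← edist_zero_right]
  refine (edist_triangle_left _ _ (f z)).trans ?_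
  push_cast
  rw [add_mul, one_mul, edist_zero_right]
  exact add_le_add h1 h2

end Modulus

/-! ### Almost monotone and slowly varying functions -/

section Monotonicity

theorem AlmostIncreasing.exists_le {f : ℝ → ℝ} (h : AlmostIncreasing f) :
    ∃ C : ℝ, 0 < C ∧ ∀ s t, 0 < s → s ≤ t → f s ≤ C * f t := by
  obtain ⟨g, hg, C, hC, hfg⟩ := h
  refine ⟨C * C, by positivity, fun s t hs hst => ?_⟩
  have ht := hs.trans_le hst
  calc f s ≤ C * g s := (hfg s hs).1
    _ ≤ C * g t := by gcongr; exact hg hs ht hst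
    _ ≤ C * (C * f t) := by gcongr; exact (hfg t ht).2
    _ = _ := by ring

theorem AlmostDecreasing.exists_le {f : ℝ → ℝ} (h : AlmostDecreasing f) :
    ∃ C : ℝ, 0 < C ∧ ∀ s t, 0 < s → s ≤ t → f t ≤ C * f s := by
  obtain ⟨g, hg, C, hC, hfg⟩ := h
  refine ⟨C * C, by positivity, fun s t hs hst => ?_⟩
  have ht := hs.trans_le hst
  calc f t ≤ C * g t := (hfg t ht).1
    _ ≤ C * g s := by gcongr; exact hg hs ht hst
    _ ≤ C * (C * f s) := by gcongr; exact (hfg s hs).2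
    _ = _ := by ring

/-- Only ε = 1 is needed: t b(t) is almost increasing and b(t)/t almost decreasing, so between
comparable arguments b changes by a bounded factor. -/
theorem SlowlyVarying.exists_le {b : ℝ → ℝ} (hb : SlowlyVarying b) {L : ℝ} (hL : 1 ≤ L) :
    ∃ C : ℝ, 0 < C ∧ ∀ s t, 0 < s → s ≤ L * t → t ≤ L * s → b s ≤ C * b t := by
  obtain ⟨C₁, hC₁, h₁⟩ := (hb.almost_increasing 1 one_pos).exists_le
  obtain ⟨C₂, hC₂, h₂⟩ := (hb.almost_decreasing 1 one_pos).exists_le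
  simp only [Real.rpow_one, Real.rpow_neg_one] at h₁ h₂
  refine ⟨(C₁ + C₂) * L, by positivity, fun s t hs hst hts => ?_⟩
  have ht : 0 < t := by
    by_contra! ht
    nlinarith
  have hbs := hb.pos s hs
  have hbt := hb.pos t ht
  rcases le_total s t with h | h
  · have := h₁ s t hs h
    have h3 : s * b s ≤ s * (C₁ * L * b t) := by
      calc s * b s ≤ C₁ * (t * b t) := this
        _ ≤ C₁ * ((L * s) * b t) := by gcongr
        _ = _ := by ring
    have h4 := le_of_mul_le_mul_left h3 hs
    have : 0 ≤ C₂ * L * b t := by positivity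
    linarith
  · have := h₂ t s ht h
    rw [inv_mul_le_iff₀ hs] at this
    have h3 : b s ≤ C₂ * L * b t := by
      calc b s ≤ s * (C₂ * (t⁻¹ * b t)) := this
        _ ≤ (L * t) * (C₂ * (t⁻¹ * b t)) := by gcongr
        _ = C₂ * L * b t * (t * t⁻¹) := by ring
        _ = _ := by rw [mul_inv_cancel₀ ht.ne', mul_one]
    have : 0 ≤ C₁ * L * b t := by positivity
    linarith

theorem SlowlyVarying.exists_rpow_div_le {b : ℝ → ℝ} (hb : SlowlyVarying b) {σ : ℝ}
    (hσ : 0 < σ) :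
    ∃ C : ℝ, 0 < C ∧ ∀ s t, 0 < s → s ≤ t → s ^ σ / b s ≤ C * (t ^ σ / b t) := by
  obtain ⟨C, hC, h⟩ := (hb.almost_decreasing σ hσ).exists_le
  refine ⟨C, hC, fun s t hs hst => ?_⟩
  have ht := hs.trans_le hst
  have hbs := hb.pos s hs
  have hbt := hb.pos t ht
  have h1 := h s t hs hst
  rw [Real.rpow_neg ht.le, Real.rpow_neg hs.le] at h1
  have hsσ := Real.rpow_pos_of_pos hs σ
  have htσ := Real.rpow_pos_of_pos ht σ
  rw [← mul_div_assoc, div_le_div_iff₀ hbs hbt]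
  field_simp at h1
  linarith

end Monotonicity

/-! ### Parameters: duality, dilation and discretisation -/

section Parameters

theorem aemeasurable_comp_exp_neg {b : ℝ → ℝ}
    (hb : AEMeasurable b (volume.restrict (Ioi (0 : ℝ)))) :
    AEMeasurable (fun u => b (Real.exp (-u))) (volume.restrict (Ioi (0 : ℝ))) := by
  have hq : Measure.QuasiMeasurePreserving (fun u => Real.exp (-u))
      (volume.restrict (Ioi (0 : ℝ))) (volume.restrict (Ioi (0 : ℝ))) := by
    refine ⟨by fun_prop, Measure.AbsolutelyContinuous.mk fun s hs h0 => ?_⟩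
    rw [Measure.restrict_apply hs] at h0
    rw [Measure.map_apply (by fun_prop) hs]
    refine Measure.absolutelyContinuous_of_le Measure.restrict_le_self ?_
    -- The preimage of a null set under e^{-u} lies in its image under -log, which is differentiable
    -- on (0,∞) and so preserves null sets.
    have h1 : volume ((fun t => -Real.log t) '' (s ∩ Ioi 0)) = 0 := by
      refine addHaar_image_eq_zero_of_differentiableOn_of_addHaar_eq_zero volume (fun t ht => ?_) h0
      exact (Real.differentiableAt_log (ne_of_gt ht.2)).neg.differentiableWithinAt
    refine measure_mono_null (fun u hu => ?_) h1
    exact ⟨Real.exp (-u), ⟨hu, Real.exp_pos _⟩, by simp⟩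
  exact hb.comp_quasiMeasurePreserving hq

theorem RISpace.lintegral_mul_lt_top {α : Type*} [MeasurableSpace α] {μ : Measure α}
    (X : RISpace μ) {h g : α → ℝ≥0∞} (hg : AEMeasurable g μ) (hh : X.assocNorm h < ∞)
    (hgX : X.nrm g < ∞) : ∫⁻ x, h x * g x ∂μ < ∞ := by
  -- Normalising by M + 1 rather than M avoids the case M = 0.
  obtain ⟨M, hM⟩ : ∃ M : ℝ≥0, X.nrm g = M := ⟨_, (ENNReal.coe_toNNReal hgX.ne).symm⟩
  have hM1 : (M + 1 : ℝ≥0) ≠ 0 := by positivity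
  have h1 : X.nrm (fun x => ((M + 1)⁻¹ : ℝ≥0) * g x) ≤ 1 := by
    rw [X.nrm_const_mul _ _ hg, hM, ← ENNReal.coe_mul, ← ENNReal.coe_one, ENNReal.coe_le_coe,
      inv_mul_le_iff₀ (by positivity), mul_one]
    exact le_self_add
  have h2 : ∫⁻ x, h x * (((M + 1)⁻¹ : ℝ≥0) * g x) ∂μ ≤ X.assocNorm h :=
    le_iSup_of_le _ (le_iSup_of_le (hg.const_mul _) (le_iSup_of_le h1 le_rfl))
  have h3 : ∀ x, h x * g x = ((M + 1 : ℝ≥0) : ℝ≥0∞) * (h x * (((M + 1)⁻¹ : ℝ≥0) * g x)) := by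
    intro x
    have : ((M + 1 : ℝ≥0) : ℝ≥0∞) * ((M + 1)⁻¹ : ℝ≥0) = 1 := by
      rw [← ENNReal.coe_mul, mul_inv_cancel₀ hM1, ENNReal.coe_one]
    calc h x * g x = (((M + 1 : ℝ≥0) : ℝ≥0∞) * ((M + 1)⁻¹ : ℝ≥0)) * (h x * g x) := by
          rw [this, one_mul]
      _ = _ := by ring
  simp_rw [h3]
  rw [lintegral_const_mul' _ _ ENNReal.coe_ne_top]
  exact ENNReal.mul_lt_top ENNReal.coe_lt_top (h2.trans_lt hh)

/-- A step function with values `a k` on `[k, k+1)` is controlled in an r.i. norm by any function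
that dominates `a k` on the `k`-th term of a sequence of intervals of fixed length with finite
overlap. -/
theorem Parameter.nrm_step_le (E : Parameter) {G : ℝ → ℝ≥0∞}
    (hG : AEMeasurable G (volume.restrict (Ioi (0 : ℝ)))) {N : ℕ} (hN : 0 < N) {n : ℝ}
    (hn : 0 < n) (hnN : n ≤ N) (v : ℝ) (a : ℕ → ℝ≥0∞)
    (ha : ∀ k, a k ≠ 0 → ∀ w ∈ Ioc (v + k / n - N / n) (v + k / n), 0 < w ∧ a k ≤ G w) :
    E.nrm (fun u => a ⌊u⌋₊) ≤ N * E.nrm G := by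
  -- Indices congruent modulo N belong to disjoint intervals: their right ends are at least N/n
  -- apart, the common length. Each residue class costs one copy of the norm of `G`.
  have hsum : (fun u : ℝ => a ⌊u⌋₊) =
      fun u : ℝ => ∑ i ∈ Finset.range N, if ⌊u⌋₊ % N = i then a ⌊u⌋₊ else 0 := by
    funext u
    rw [Finset.sum_ite_eq, if_pos (Finset.mem_range.2 (Nat.mod_lt _ hN))]
  have hmeas : ∀ i, AEMeasurable (fun u : ℝ => if ⌊u⌋₊ % N = i then a ⌊u⌋₊ else 0)
      (volume.restrict (Ioi (0 : ℝ))) := fun i =>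
    ((measurable_from_nat (f := fun m : ℕ => if m % N = i then a m else 0)).comp
      Nat.measurable_floor).aemeasurable
  rw [hsum]
  refine (E.nrm_sum_le _ _ hmeas).trans ?_
  have key : ∀ i ∈ Finset.range N,
      E.nrm (fun u : ℝ => if ⌊u⌋₊ % N = i then a ⌊u⌋₊ else 0) ≤ E.nrm G := by
    intro i _
    refine E.nrm_le_of_distribution_le (hmeas i) hG fun t => ?_
    let S : Set ℕ := {k | k % N = i ∧ t < a k}
    let I : S → Set ℝ := fun k => Ioc (v + (k : ℕ) / n - N / n) (v + (k : ℕ) / n)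
    have hI : ∀ k, volume (I k) = ENNReal.ofReal (N / n) := fun k => by
      simp only [I, Real.volume_Ioc]
      congr 1
      ring
    have hdisj : Pairwise (Function.onFun Disjoint I) := by
      have aux : ∀ j k : S, (j : ℕ) < k → Disjoint (I j) (I k) := by
        intro j k hjk
        have hle : (j : ℕ) + N ≤ k := by
          have h1 : (j : ℕ) ≡ k [MOD N] := j.2.1.trans k.2.1.symm
          have h2 := (Nat.modEq_iff_dvd' hjk.le).1 h1
          have h3 := Nat.le_of_dvd (by omega) h2
          omega
        have hle' : ((j : ℕ) : ℝ) + N ≤ (k : ℕ) := by exact_mod_cast hle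
        refine Set.disjoint_left.2 fun w hw hw' => ?_
        have h1 : w ≤ v + (j : ℕ) / n := hw.2
        have h2 : v + (k : ℕ) / n - N / n < w := hw'.1
        have h3 : (((j : ℕ) : ℝ) + N) / n ≤ (k : ℕ) / n := by gcongr
        rw [add_div] at h3
        linarith
      intro j k hjk
      rcases lt_or_gt_of_ne (fun h => hjk (Subtype.ext h)) with h | h
      · exact aux j k h
      · exact (aux k j h).symm
    have hsubG : (⋃ k, I k) ⊆ {w | t < G w} ∩ Ioi 0 := by
      refine iUnion_subset fun k w hw => ?_
      obtain ⟨h1, h2⟩ := ha k (ne_of_gt (lt_of_le_of_lt zero_le k.2.2)) w hw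
      exact ⟨k.2.2.trans_le h2, h1⟩
    calc (volume.restrict (Ioi (0 : ℝ))) {u : ℝ | t < if ⌊u⌋₊ % N = i then a ⌊u⌋₊ else 0}
        ≤ (volume.restrict (Ioi (0 : ℝ))) ((⋃ k : S, Ico ((k : ℕ) : ℝ) ((k : ℕ) + 1)) ∪ Iio 0) := by
          refine measure_mono fun u hu => ?_
          rcases lt_or_ge u 0 with h0 | h0
          · exact Or.inr h0
          · have hu : t < if ⌊u⌋₊ % N = i then a ⌊u⌋₊ else 0 := hu
            split_ifs at hu with hui
            · exact Or.inl (mem_iUnion.2 ⟨⟨⌊u⌋₊, hui, hu⟩, Nat.floor_le h0, Nat.lt_floor_add_one u⟩)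
            · exact absurd hu not_lt_zero
      _ ≤ (volume.restrict (Ioi (0 : ℝ))) (⋃ k : S, Ico ((k : ℕ) : ℝ) ((k : ℕ) + 1)) + 0 := by
          refine (measure_union_le _ _).trans ?_
          gcongr
          rw [Measure.restrict_apply measurableSet_Iio, Iio_inter_Ioi, Ioo_self, measure_empty]
      _ ≤ volume (⋃ k : S, Ico ((k : ℕ) : ℝ) ((k : ℕ) + 1)) := by
          rw [add_zero]
          exact Measure.restrict_apply_le _ _
      _ ≤ ∑' k : S, volume (Ico ((k : ℕ) : ℝ) ((k : ℕ) + 1)) := measure_iUnion_le _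
      _ ≤ ∑' k : S, volume (I k) := by
          -- Here n ≤ N enters: each interval has length N/n ≥ 1, the length of a step.
          refine ENNReal.tsum_le_tsum fun k => ?_
          rw [hI, Real.volume_Ico]
          refine ENNReal.ofReal_le_ofReal ?_
          rw [add_sub_cancel_left]
          exact (one_le_div hn).2 hnN
      _ = volume (⋃ k, I k) := (measure_iUnion hdisj fun k => measurableSet_Ioc).symm
      _ ≤ volume ({w | t < G w} ∩ Ioi 0) := measure_mono hsubG
      _ ≤ _ := Measure.le_restrict_apply _ _
  calc _ ≤ ∑ _i ∈ Finset.range N, E.nrm G := Finset.sum_le_sum key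
    _ = _ := by simp

theorem tsum_le_lintegral_of_le {F : ℝ → ℝ≥0∞} {d : ℕ → ℝ≥0∞}
    (h : ∀ (k : ℕ), ∀ u ∈ Ioo (k : ℝ) (k + 1), d k ≤ F u) :
    ∑' k, d k ≤ ∫⁻ u in Ioi (0 : ℝ), F u := by
  have hdisj : Pairwise (Function.onFun Disjoint fun k : ℕ => Ioo (k : ℝ) (k + 1)) := by
    have aux : ∀ j k : ℕ, j < k → Disjoint (Ioo (j : ℝ) (j + 1)) (Ioo (k : ℝ) (k + 1)) := by
      intro j k hjk
      have : (j : ℝ) + 1 ≤ k := by exact_mod_cast hjk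
      exact Set.disjoint_left.2 fun w hw hw' => by linarith [hw.2, hw'.1]
    intro j k hjk
    rcases lt_or_gt_of_ne hjk with h | h
    · exact aux j k h
    · exact (aux k j h).symm
  calc ∑' k, d k ≤ ∑' k : ℕ, ∫⁻ u in Ioo (k : ℝ) (k + 1), F u := by
        refine ENNReal.tsum_le_tsum fun k => ?_
        calc d k = ∫⁻ _ in Ioo (k : ℝ) (k + 1), d k := by simp
          _ ≤ _ := setLIntegral_mono' measurableSet_Ioo (h k)
    _ = ∫⁻ u in ⋃ k : ℕ, Ioo (k : ℝ) (k + 1), F u :=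
        (lintegral_iUnion (fun _ => measurableSet_Ioo) hdisj F).symm
    _ ≤ _ := lintegral_mono_set (iUnion_subset fun k u hu =>
        lt_of_le_of_lt (Nat.cast_nonneg k) hu.1)

end Parameters

/-! ### Continuous representatives as limits of averages -/

section Limits

variable {Ω : Type*} [MetricSpace Ω]

theorem continuous_of_edist_le_tsum {g : Ω → ℝ} {R q : ℝ} (hR : 0 < R) (hq : 0 < q)
    {D : ℕ → ℝ≥0∞} (hD : ∑' j, D j ≠ ∞)
    (hg : ∀ (j : ℕ) (x y : Ω), dist x y ≤ R * q ^ j → edist (g x) (g y) ≤ 3 * ∑' i, D (j + i)) :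
    Continuous g := by
  have ht : Tendsto (fun j => 3 * ∑' i, D (j + i)) atTop (𝓝 0) := by
    have := ENNReal.Tendsto.const_mul (a := 3) (ENNReal.tendsto_sum_nat_add D hD) (by simp)
    simpa [add_comm] using this
  rw [EMetric.continuous_iff]
  intro x ε hε
  obtain ⟨j, hj⟩ := (ht.eventually (gt_mem_nhds hε)).exists
  refine ⟨ENNReal.ofReal (R * q ^ j), by simp; positivity, fun y hy => ?_⟩
  refine (hg j y x ?_).trans_lt hj
  rw [edist_dist] at hy
  exact ((ENNReal.ofReal_lt_ofReal_iff (by positivity)).1 hy).le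

variable [MeasurableSpace Ω] {μ : Measure Ω} {k n : ℝ}

theorem MemHomBesov.aemeasurable {X : RISpace μ} {E : Parameter} {θ : ℝ} {b : ℝ → ℝ} {f : Ω → ℝ}
    (hf : MemHomBesov X E θ b f) : AEMeasurable f μ := by
  obtain ⟨⟨g, g', hg, hg', hfg⟩, -⟩ := hf
  exact (hg.1.add hg'.1).aemeasurable.congr hfg.symm

theorem MemHomBesov.integrableOn_ball (h : IsRDSpace μ k n) {X : RISpace μ} {E : Parameter}
    {θ : ℝ} {b : ℝ → ℝ} {f : Ω → ℝ} (hf : MemHomBesov X E θ b f) (x : Ω) (r : ℝ) :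
    IntegrableOn f (Metric.ball x r) μ := by
  obtain ⟨⟨g, g', hg, hg', hfg⟩, -⟩ := hf
  rcases le_or_gt r 0 with hr | hr
  · rw [Metric.ball_eq_empty.2 hr]
    exact integrableOn_empty
  · have : Fact (μ (Metric.ball x r) < ∞) := ⟨h.ball_lt_top x r hr⟩
    have h1 : IntegrableOn g (Metric.ball x r) μ := (memLp_one_iff_integrable.1 hg).integrableOn
    have h2 : IntegrableOn g' (Metric.ball x r) μ :=
      (hg'.restrict (Metric.ball x r)).integrable le_top
    exact (h1.add h2).congr (ae_restrict_of_ae hfg.symm)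

variable [BorelSpace Ω]

/-- If the averages of `f` over comparable neighbouring balls of radius about `R q ^ j` differ by
at most `D j`, with `D` summable, then they converge to a representative of `f`. -/
theorem exists_representative_of_average_osc (h : IsRDSpace μ k n) {f : Ω → ℝ}
    (hf : ∀ x r, IntegrableOn f (Metric.ball x r) μ) {R q : ℝ} (hR : 0 < R) (hq : 0 < q)
    (hq1 : q < 1) {D : ℕ → ℝ≥0∞} (hD : ∑' j, D j ≠ ∞)
    (hosc : ∀ (j : ℕ) (x y : Ω) (s s' : ℝ), R * q ^ (j + 1) ≤ s → s ≤ R * q ^ j →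
      R * q ^ (j + 1) ≤ s' → s' ≤ R * q ^ j → dist x y ≤ R * q ^ j →
      edist (⨍ w in Metric.closedBall x s, f w ∂μ) (⨍ w in Metric.closedBall y s', f w ∂μ) ≤ D j) :
    ∃ g : Ω → ℝ, f =ᵐ[μ] g ∧
      (∀ j x, edist (⨍ w in Metric.closedBall x (R * q ^ j), f w ∂μ) (g x) ≤ ∑' i, D (j + i)) ∧
      ∀ (j : ℕ) (x y : Ω), dist x y ≤ R * q ^ j → edist (g x) (g y) ≤ 3 * ∑' i, D (j + i) := by
  have := h.secondCountable
  have := h.isLocallyFinite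
  have := h.isUnifLocDoubling
  have hstep : ∀ j, R * q ^ (j + 1) ≤ R * q ^ j := fun j =>
    mul_le_mul_of_nonneg_left (pow_le_pow_of_le_one hq.le hq1.le (Nat.le_succ j)) hR.le
  have hpos : ∀ j, 0 < R * q ^ j := fun j => by positivity
  let A : ℕ → Ω → ℝ := fun j x => ⨍ w in Metric.closedBall x (R * q ^ j), f w ∂μ
  have hA : ∀ x j, edist (A j x) (A (j + 1) x) ≤ D j := fun x j =>
    hosc j x x _ _ (hstep j) le_rfl le_rfl (hstep j) (by simpa using (hpos j).le)
  have hlim : ∀ x, ∃ a, Tendsto (fun j => A j x) atTop (𝓝 a) := fun x =>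
    cauchySeq_tendsto_of_complete (cauchySeq_of_edist_le_of_tsum_ne_top D (hA x) hD)
  choose g hg using hlim
  have hAg : ∀ j x, edist (A j x) (g x) ≤ ∑' i, D (j + i) := fun j x =>
    edist_le_tsum_of_edist_le_of_tendsto D (hA x) (hg x) j
  refine ⟨g, ?_, hAg, fun j x y hxy => ?_⟩
  · have hloc : LocallyIntegrable f μ := fun x =>
      ⟨Metric.ball x 1, Metric.ball_mem_nhds x one_pos, hf x 1⟩
    -- Almost everywhere the averages over shrinking closed balls also tend to f(x), so the limit is
    -- f(x).
    filter_upwards [IsUnifLocDoublingMeasure.ae_tendsto_average μ hloc 1] with x hx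
    refine tendsto_nhds_unique (hx (fun _ => x) (fun j : ℕ => R * q ^ j) ?_ ?_) (hg x)
    · refine tendsto_nhdsWithin_iff.2 ⟨?_, Eventually.of_forall hpos⟩
      simpa using (tendsto_pow_atTop_nhds_zero_of_lt_one hq.le hq1).const_mul R
    · exact Eventually.of_forall fun j => Metric.mem_closedBall_self (by simpa using (hpos j).le)
  · have h1 : edist (A j x) (A j y) ≤ ∑' i, D (j + i) :=
      (hosc j x y _ _ (hstep j) le_rfl (hstep j) le_rfl hxy).trans
        (ENNReal.le_tsum (f := fun i => D (j + i)) 0)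
    calc edist (g x) (g y) ≤ edist (g x) (A j x) + edist (A j x) (A j y) + edist (A j y) (g y) :=
          edist_triangle4 _ _ _ _
      _ ≤ (∑' i, D (j + i)) + (∑' i, D (j + i)) + ∑' i, D (j + i) := by
          gcongr
          · rw [edist_comm]; exact hAg j x
          · exact hAg j y
      _ = _ := by ring

theorem aemeasurable_weightedModulus_exp_neg (h : IsRDSpace μ k n) (X : RISpace μ) {b : ℝ → ℝ}
    (hb : SlowlyVarying b) (θ : ℝ) {f : Ω → ℝ} (hf : AEMeasurable f μ) :
    AEMeasurable (fun u => weightedModulus X θ b f (Real.exp (-u)))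
      (volume.restrict (Ioi (0 : ℝ))) := by
  refine AEMeasurable.mul (AEMeasurable.ennreal_ofReal (AEMeasurable.mul ?_
    (aemeasurable_comp_exp_neg hb.measurable))) ?_
  · exact (by fun_prop : Measurable fun u : ℝ => Real.exp (-u) ^ (-θ)).aemeasurable
  · exact ((measurable_modulus h X hf).comp (by fun_prop)).aemeasurable

end Limits

/-! ### Part (i): essential continuity -/

section Continuity

variable {Ω : Type*} [MetricSpace Ω] [MeasurableSpace Ω] [BorelSpace Ω] {μ : Measure Ω} {k n : ℝ}

/-- At comparable arguments the weighted moduli are comparable. -/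
theorem exists_mul_modulus_le_weightedModulus (h : IsRDSpace μ k n) {b : ℝ → ℝ}
    (hb : SlowlyVarying b) {θ : ℝ} (hθ : 0 < θ) {L : ℝ} (hL : 1 ≤ L) :
    ∃ C : ℝ≥0, C ≠ 0 ∧ ∀ (X : RISpace μ) (f : Ω → ℝ), AEMeasurable f μ → ∀ r s t : ℝ, 0 < r →
      r ≤ s → s ≤ t → t ≤ L * r →
      ENNReal.ofReal (r ^ (-θ) * b r) * modulus X f s ≤ C * weightedModulus X θ b f t := by
  obtain ⟨C₁, hC₁⟩ := exists_modulus_le h hL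
  obtain ⟨C₂, hC₂0, hC₂⟩ := hb.exists_le hL
  refine ⟨(L ^ θ * C₂).toNNReal * C₁ + 1, by positivity, fun X f hf r s t hr hrs hst htL => ?_⟩
  have ht : 0 < t := by linarith
  have hrL : r ≤ L * t := by nlinarith
  have h1 := hC₁ X f hf s t (by linarith) hst (by nlinarith)
  have h2 : r ^ (-θ) * b r ≤ (L ^ θ * C₂) * (t ^ (-θ) * b t) := by
    have h3 := hC₂ r t hr hrL htL
    have h4 : r ^ (-θ) ≤ L ^ θ * t ^ (-θ) := by
      rw [Real.rpow_neg hr.le, Real.rpow_neg ht.le, ← div_eq_mul_inv,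
        ← Real.div_rpow (by linarith) ht.le, ← Real.inv_rpow hr.le]
      refine Real.rpow_le_rpow (by positivity) ?_ hθ.le
      rw [inv_eq_one_div, div_le_div_iff₀ hr ht]
      linarith
    have := hb.pos r hr
    calc r ^ (-θ) * b r ≤ (L ^ θ * t ^ (-θ)) * (C₂ * b t) := by gcongr
      _ = _ := by ring
  calc ENNReal.ofReal (r ^ (-θ) * b r) * modulus X f s
      ≤ ENNReal.ofReal ((L ^ θ * C₂) * (t ^ (-θ) * b t)) * (C₁ * modulus X f t) := by
        gcongr
    _ = ((L ^ θ * C₂).toNNReal * C₁ : ℝ≥0) * weightedModulus X θ b f t := by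
        rw [ENNReal.ofReal_mul (by positivity), weightedModulus, ENNReal.coe_mul, ENNReal.ofReal]
        ring
    _ ≤ _ := by
        gcongr
        exact le_self_add

/-- On each (k,k+1) the integrand of the E–E' pairing is at least a constant times the k-th term,
because t^θ and b vary by bounded factors there and φ_X is increasing. The shift A leaves room for
the factor 4 in E_X(f,4r) and for the non-collapsing constant. -/
theorem exists_tsum_modulus_div_ne_top (h : IsRDSpace μ k n) [Nonempty Ω] (X : RISpace μ)
    (E : Parameter) {b : ℝ → ℝ} (hb : SlowlyVarying b) {θ : ℝ} (hθ : 0 < θ)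
    (hE : tildeAssocNormZeroOne E
        (fun t => ENNReal.ofReal (t ^ (θ / n) / (b (t ^ (1 / n)) * X.fundamental t))) < ∞)
    {f : Ω → ℝ} (hf : AEMeasurable f μ)
    (hfE : tildeNormZeroOne E (weightedModulus X θ b f) < ∞) {A : ℝ} (hA : 0 ≤ A) :
    ∃ K : ℕ, A ≤ K / n ∧
      ∑' j : ℕ, modulus X f (Real.exp (A - (K + j : ℕ) / n)) /
        ENNReal.ofReal (X.fundamental (Real.exp (-(K + j : ℕ)))) ≠ ∞ := by
  have hn := h.n_pos
  set N := ⌈n⌉₊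
  have hN : 0 < N := Nat.ceil_pos.2 hn
  have hnN : n ≤ N := Nat.le_ceil n
  -- L bounds two ratios: e^{-w}/τ_k for w in the k-th interval, at most e^{A+N/n}, and
  -- e^{-k/n}/e^{-u/n} for u in (k,k+1), at most e^{1/n}.
  set L := Real.exp (A + (N + 1) / n)
  have hL : 1 ≤ L := Real.one_le_exp (by positivity)
  obtain ⟨C, hC0, hC⟩ := exists_mul_modulus_le_weightedModulus h hb hθ hL
  obtain ⟨C₂, hC₂0, hC₂⟩ := hb.exists_le hL
  -- From this index on the intervals in `Parameter.nrm_step_le` lie in (0,∞).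
  obtain ⟨K, hK⟩ := exists_nat_ge (n * (A + N / n))
  have hK : A + N / n ≤ K / n := by rw [le_div_iff₀ hn]; linarith
  refine ⟨K, by have : 0 ≤ (N : ℝ) / n := by positivity
                linarith, ?_⟩
  let τ : ℕ → ℝ := fun k => Real.exp (-(k / n))
  let a : ℕ → ℝ≥0∞ := fun k => if K ≤ k then
    ENNReal.ofReal (τ k ^ (-θ) * b (τ k)) * modulus X f (Real.exp (A - k / n)) else 0
  let G : ℝ → ℝ≥0∞ := fun u => C * weightedModulus X θ b f (Real.exp (-u))
  have hG := aemeasurable_weightedModulus_exp_neg h X hb θ hf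
  have hstep : E.nrm (fun u => a ⌊u⌋₊) < ∞ := by
    refine (E.nrm_step_le (G := G) (hG.const_mul _) hN hn hnN (-A) a fun k hk w hw => ?_).trans_lt
      ?_
    · have hKk : K ≤ k := by
        by_contra hc
        exact hk (if_neg hc)
      have hKk' : (K : ℝ) / n ≤ k / n := by gcongr
      have h1 := hw.1
      have h2 := hw.2
      refine ⟨by linarith, ?_⟩
      simp only [a, if_pos hKk, G]
      refine hC X f hf _ _ _ (Real.exp_pos _) (Real.exp_le_exp.2 (by linarith))
        (Real.exp_le_exp.2 (by linarith)) ?_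
      rw [← Real.exp_add]
      refine Real.exp_le_exp.2 ?_
      rw [add_div]
      have : 0 ≤ 1 / n := by positivity
      linarith
    · rw [E.nrm_const_mul _ _ hG]
      exact ENNReal.mul_lt_top (by simp) (ENNReal.mul_lt_top (by simp) hfE)
  have ham : AEMeasurable (fun u : ℝ => a ⌊u⌋₊) (volume.restrict (Ioi (0 : ℝ))) :=
    ((measurable_from_nat (f := a)).comp Nat.measurable_floor).aemeasurable
  have hint := E.lintegral_mul_lt_top ham hE hstep
  -- The loss on a unit step: e^{-u/n} ≥ e^{-1/n} τ_k, and b changes by a factor at most C₂.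
  set κ : ℝ := Real.exp (-(1 / n)) ^ θ / C₂
  have hκ : 0 < κ := by positivity
  have hφ : ∀ s : ℝ, 0 < X.fundamental (Real.exp s) := fun s =>
    X.fundamental_pos h (Real.exp_pos s)
  let d : ℕ → ℝ≥0∞ := fun k => if K ≤ k then ENNReal.ofReal κ *
    (modulus X f (Real.exp (A - k / n)) / ENNReal.ofReal (X.fundamental (Real.exp (-k)))) else 0
  have hd : ∑' k, d k < ∞ := by
    refine (tsum_le_lintegral_of_le fun k u hu => ?_).trans_lt hint
    have hfl : ⌊u⌋₊ = k := (Nat.floor_eq_iff ((Nat.cast_nonneg k).trans hu.1.le)).2 ⟨hu.1.le, hu.2⟩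
    rw [hfl]
    by_cases hKk : K ≤ k
    swap
    · simp [d, a, hKk]
    simp only [d, a, if_pos hKk]
    have hτ : 0 < τ k := Real.exp_pos _
    have hbτ := hb.pos _ hτ
    have e1 : Real.exp (-u) ^ (1 / n) = Real.exp (-(u / n)) := by
      rw [← Real.exp_mul]; congr 1; ring
    have e2 : Real.exp (-u) ^ (θ / n) = Real.exp (-(u / n)) ^ θ := by
      rw [← Real.exp_mul, ← Real.exp_mul]; congr 1; ring
    have hu1 : (k : ℝ) / n ≤ u / n := by gcongr; exact hu.1.le
    have hu2 : u / n ≤ k / n + 1 / n := by rw [← add_div]; gcongr; exact hu.2.le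
    have hNn : 0 ≤ (N : ℝ) / n := by positivity
    have hn1 : 0 ≤ 1 / n := by positivity
    have h1 : Real.exp (-(1 / n)) * τ k ≤ Real.exp (-(u / n)) := by
      rw [← Real.exp_add]; exact Real.exp_le_exp.2 (by linarith)
    have h2 : b (Real.exp (-(u / n))) ≤ C₂ * b (τ k) := by
      refine hC₂ _ _ (Real.exp_pos _) ?_ ?_ <;> rw [← Real.exp_add] <;>
        refine Real.exp_le_exp.2 ?_ <;> rw [add_div] <;> linarith
    have h3 : X.fundamental (Real.exp (-u)) ≤ X.fundamental (Real.exp (-k)) :=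
      X.fundamental_mono h (Real.exp_pos _) (Real.exp_le_exp.2 (by linarith [hu.1]))
    have hreal : κ / X.fundamental (Real.exp (-k)) ≤
        Real.exp (-u) ^ (θ / n) / (b (Real.exp (-u) ^ (1 / n)) * X.fundamental (Real.exp (-u))) *
          (τ k ^ (-θ) * b (τ k)) := by
      rw [e1, e2]
      have hbu := hb.pos _ (Real.exp_pos (-(u / n)))
      have h4 : (Real.exp (-(1 / n)) * τ k) ^ θ ≤ Real.exp (-(u / n)) ^ θ :=
        Real.rpow_le_rpow (by positivity) h1 hθ.le
      calc κ / X.fundamental (Real.exp (-k))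
          = (Real.exp (-(1 / n)) * τ k) ^ θ / ((C₂ * b (τ k)) * X.fundamental (Real.exp (-k))) *
            (τ k ^ (-θ) * b (τ k)) := by
            rw [Real.mul_rpow (Real.exp_pos _).le hτ.le, Real.rpow_neg hτ.le]
            have := Real.rpow_pos_of_pos hτ θ
            have := hφ (-k)
            simp only [κ]
            field_simp
        _ ≤ _ := by
            have := hφ (-u)
            gcongr
    calc ENNReal.ofReal κ * (modulus X f (Real.exp (A - k / n)) /
          ENNReal.ofReal (X.fundamental (Real.exp (-k))))
        = ENNReal.ofReal (κ / X.fundamental (Real.exp (-k))) *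
            modulus X f (Real.exp (A - k / n)) := by
          rw [ENNReal.ofReal_div_of_pos (hφ _), ENNReal.div_eq_inv_mul, ENNReal.div_eq_inv_mul]
          ring
      _ ≤ _ := by
          rw [← mul_assoc, ← ENNReal.ofReal_mul]
          · gcongr
          · have := hb.pos _ (Real.rpow_pos_of_pos (Real.exp_pos (-u)) (1 / n))
            have := hφ (-u)
            positivity
  have hκ' : ENNReal.ofReal κ ≠ 0 := by simpa using hκ
  have hle : ENNReal.ofReal κ * ∑' j : ℕ, modulus X f (Real.exp (A - (K + j : ℕ) / n)) /
        ENNReal.ofReal (X.fundamental (Real.exp (-(K + j : ℕ)))) ≤ ∑' k, d k := by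
    rw [← ENNReal.tsum_mul_left]
    refine le_trans (ENNReal.tsum_le_tsum fun j => ?_)
      (ENNReal.tsum_comp_le_tsum_of_injective (add_right_injective K) d)
    simp [d]
  intro htop
  rw [htop, ENNReal.mul_top hκ'] at hle
  exact absurd (hle.trans_lt hd) (lt_irrefl _)

theorem essentiallyContinuous_of_memBesov (h : IsRDSpace μ k n) (hnc : IsNonCollapsing μ)
    (X : RISpace μ) (E : Parameter) {b : ℝ → ℝ} (hb : SlowlyVarying b) {θ : ℝ} (hθ : 0 < θ)
    (hE : tildeAssocNormZeroOne E
        (fun t => ENNReal.ofReal (t ^ (θ / n) / (b (t ^ (1 / n)) * X.fundamental t))) < ∞)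
    {f : Ω → ℝ} (hf : MemBesov X E θ b f) : EssentiallyContinuous μ f := by
  rcases isEmpty_or_nonempty Ω with he | hne
  · exact ⟨f, continuous_iff_continuousAt.2 fun x => isEmptyElim x, ae_eq_refl _⟩
  have hn := h.n_pos
  have hfm := hf.1.aemeasurable
  have hfi := hf.1.integrableOn_ball h
  obtain ⟨c, hc, hcB⟩ := h.exists_ball_lower hnc
  -- With c e^{c₀} ≥ 1, the radius e^{(c₀-k)/n} gives a ball of measure at least e^{-k}, as long as
  -- it is at most 1; the choice of K ensures that.
  set c₀ := max 0 (-Real.log c)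
  have hc₀ : 0 ≤ c₀ := le_max_left _ _
  have hcc : 1 ≤ c * Real.exp c₀ := by
    calc 1 = c * Real.exp (-Real.log c) := by
          rw [Real.exp_neg, Real.exp_log hc, mul_inv_cancel₀ hc.ne']
      _ ≤ _ := by gcongr; exact le_max_right _ _
  have hlog4 : 0 ≤ Real.log 4 := Real.log_nonneg (by norm_num)
  obtain ⟨K, hK, hsum⟩ := exists_tsum_modulus_div_ne_top h X E hb hθ hE hfm hf.1.2.1
    (A := Real.log 4 + c₀ / n) (by positivity)
  set q := Real.exp (-(1 / n))
  set R := Real.exp (c₀ / n - K / n)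
  have hq1 : q < 1 := by
    refine Real.exp_lt_one_iff.2 ?_
    have : 0 < 1 / n := by positivity
    linarith
  have hL : 1 ≤ q⁻¹ := (one_le_inv₀ (Real.exp_pos _)).2 hq1.le
  obtain ⟨C, hC⟩ := exists_edist_average_average_le h hL
  have hRq : ∀ j : ℕ, R * q ^ j = Real.exp (c₀ / n - (K + j : ℕ) / n) := by
    intro j
    rw [← Real.exp_nat_mul, ← Real.exp_add]
    congr 1
    push_cast
    ring
  have hRq4 : ∀ j : ℕ, 4 * (R * q ^ j) = Real.exp (Real.log 4 + c₀ / n - (K + j : ℕ) / n) := by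
    intro j
    rw [hRq, add_sub_assoc, Real.exp_add, Real.exp_log (by norm_num)]
  let D : ℕ → ℝ≥0∞ := fun j => C * (modulus X f (4 * (R * q ^ j)) /
    ENNReal.ofReal (X.fundamental (Real.exp (-(K + j : ℕ)))))
  have hD : ∑' j, D j ≠ ∞ := by
    simp only [D, hRq4]
    rw [ENNReal.tsum_mul_left]
    exact ENNReal.mul_ne_top ENNReal.coe_ne_top hsum
  obtain ⟨g, hfg, -, hg⟩ := exists_representative_of_average_osc h hfi (R := R) (q := q)
    (Real.exp_pos _) (Real.exp_pos _) hq1 hD (fun j x y s s' hs hs1 hs' hs1' hxy => by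
      have hr : 0 < R * q ^ j := by positivity
      have hq0 : 0 < q := Real.exp_pos _
      have aux : ∀ s, R * q ^ (j + 1) ≤ s → R * q ^ j ≤ q⁻¹ * s := fun s hs => by
        rw [pow_succ] at hs
        rw [inv_mul_eq_div, le_div_iff₀ hq0]
        linarith
      refine (hC X f hfm hfi x y _ s s' hr (aux s hs) hs1 (aux s' hs') hs1' hxy).trans ?_
      simp only [D]
      gcongr
      refine X.ofReal_fundamental_le h (Real.exp_pos _) measurableSet_ball ?_
      refine le_trans (ENNReal.ofReal_le_ofReal ?_) (hcB x _ hr ?_)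
      · rw [hRq, ← Real.exp_mul]
        calc Real.exp (-(K + j : ℕ)) ≤ (c * Real.exp c₀) * Real.exp (-(K + j : ℕ)) :=
              le_mul_of_one_le_left (Real.exp_pos _).le hcc
          _ = _ := by
              rw [mul_assoc, ← Real.exp_add]
              congr 2
              field_simp
              ring
      · rw [hRq]
        refine Real.exp_le_one_iff.2 ?_
        have : (K : ℝ) / n ≤ (K + j : ℕ) / n := by gcongr; simp
        linarith)
  exact ⟨g, continuous_of_edist_le_tsum (Real.exp_pos _) (Real.exp_pos _) hD hg, hfg⟩

end Continuity

/-! ### Part (ii): the Hölder-type estimate -/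

section Hoelder

variable {Ω : Type*} [MetricSpace Ω] [MeasurableSpace Ω] [BorelSpace Ω] {μ : Measure Ω} {k n : ℝ}

/-- The exponent is split in two: r^{σ/2}/b(r) is almost increasing, and the other r^{σ/2} gives a
geometric series of ratio 2^{-σ/2}. -/
theorem SlowlyVarying.exists_tsum_rpow_div_le {b : ℝ → ℝ} (hb : SlowlyVarying b) {σ : ℝ}
    (hσ : 0 < σ) :
    ∃ C : ℝ, 0 < C ∧ ∀ r : ℝ, 0 < r →
      ∑' i : ℕ, ENNReal.ofReal ((r * (1 / 2) ^ i) ^ σ / b (r * (1 / 2) ^ i)) ≤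
        ENNReal.ofReal (C * (r ^ σ / b r)) := by
  obtain ⟨C, hC, h⟩ := hb.exists_rpow_div_le (half_pos hσ)
  set p : ℝ := (1 / 2) ^ (σ / 2)
  have hp : 0 < p := by positivity
  have hp1 : p < 1 := Real.rpow_lt_one (by norm_num) (by norm_num) (half_pos hσ)
  have hp2 : 0 < 1 - p := by linarith
  refine ⟨C * (1 - p)⁻¹, by positivity, fun r hr => ?_⟩
  have hbr := hb.pos r hr
  have hsq : ∀ t : ℝ, 0 < t → t ^ σ = t ^ (σ / 2) * t ^ (σ / 2) := fun t ht => by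
    rw [← Real.rpow_add ht, add_halves]
  have key : ∀ i : ℕ, (r * (1 / 2) ^ i) ^ σ / b (r * (1 / 2) ^ i) ≤
      C * (r ^ σ / b r) * p ^ i := by
    intro i
    have hs : 0 < r * (1 / 2) ^ i := by positivity
    have h1 := h _ r hs (mul_le_of_le_one_right hr.le (pow_le_one₀ (by norm_num) (by norm_num)))
    have h2 : (r * (1 / 2) ^ i) ^ (σ / 2) = r ^ (σ / 2) * p ^ i := by
      rw [Real.mul_rpow hr.le (by positivity), ← Real.rpow_natCast, ← Real.rpow_natCast,
        ← Real.rpow_mul (by norm_num), ← Real.rpow_mul (by norm_num), mul_comm (σ / 2)]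
    rw [hsq _ hs, hsq r hr, mul_div_assoc]
    calc _ ≤ (r * (1 / 2) ^ i) ^ (σ / 2) * (C * (r ^ (σ / 2) / b r)) := by gcongr
      _ = _ := by rw [h2]; ring
  calc ∑' i : ℕ, ENNReal.ofReal ((r * (1 / 2) ^ i) ^ σ / b (r * (1 / 2) ^ i))
      ≤ ∑' i : ℕ, ENNReal.ofReal (C * (r ^ σ / b r) * p ^ i) :=
        ENNReal.tsum_le_tsum fun i => ENNReal.ofReal_le_ofReal (key i)
    _ = ENNReal.ofReal (∑' i : ℕ, C * (r ^ σ / b r) * p ^ i) :=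
        (ENNReal.ofReal_tsum_of_nonneg (fun i => by positivity)
          ((summable_geometric_of_lt_one hp.le hp1).mul_left _)).symm
    _ = _ := by
        rw [tsum_mul_left, tsum_geometric_of_lt_one hp.le hp1]
        congr 1
        ring

/-- On the unit interval of u with t ≤ e^{-u} < e t, the weighted modulus is bounded below by a
multiple of its value at t, and all unit intervals have the same norm in E. The restriction t ≤ 1/4
< 1/e keeps the interval inside (0,∞). -/
theorem exists_modulus_le_rpow (h : IsRDSpace μ k n) (X : RISpace μ) (E : Parameter) {b : ℝ → ℝ}
    (hb : SlowlyVarying b) {θ : ℝ} (hθ : 0 < θ) :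
    ∃ C : ℝ≥0, ∀ f : Ω → ℝ, AEMeasurable f μ → ∀ t : ℝ, 0 < t → t ≤ 1 / 4 →
      modulus X f t ≤ C * tildeNormZeroOne E (weightedModulus X θ b f) *
        ENNReal.ofReal (t ^ θ / b t) := by
  obtain ⟨C, hC0, hC⟩ := exists_mul_modulus_le_weightedModulus h hb hθ
    (Real.one_le_exp zero_le_one)
  have hJ1 : (volume.restrict (Ioi (0 : ℝ))) (Ioc 0 1) = 1 := by
    rw [Measure.restrict_apply measurableSet_Ioc, inter_eq_left.2 Ioc_subset_Ioi_self]
    simp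
  set m := E.nrm ((Ioc (0 : ℝ) 1).indicator fun _ => 1)
  have hm0 : m ≠ 0 := E.nrm_indicator_ne_zero measurableSet_Ioc (by simp [hJ1])
  have hmt : m ≠ ∞ := (E.nrm_indicator_lt_top _ measurableSet_Ioc (by simp [hJ1])).ne
  refine ⟨C * m.toNNReal⁻¹, fun f hf t ht ht4 => ?_⟩
  set T := tildeNormZeroOne E (weightedModulus X θ b f)
  set J := Ioc (-Real.log t - 1) (-Real.log t)
  have hlog : 1 < -Real.log t := by
    have h1 : Real.log t ≤ Real.log (1 / 4) := Real.log_le_log ht ht4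
    have h2 : Real.log (1 / 4) < -1 := by
      rw [Real.log_lt_iff_lt_exp (by norm_num), Real.exp_neg, one_div]
      exact inv_strictAnti₀ (Real.exp_pos _) (by linarith [Real.exp_one_lt_d9])
    linarith
  have hJ : (volume.restrict (Ioi (0 : ℝ))) J = 1 := by
    rw [Measure.restrict_apply measurableSet_Ioc, inter_eq_left.2
      fun u hu => mem_Ioi.2 (by linarith [hu.1])]
    simp
  have hmJ : m ≤ E.nrm (J.indicator fun _ => 1) :=
    E.nrm_indicator_mono measurableSet_Ioc measurableSet_Ioc (by rw [hJ1, hJ])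
  have hG := aemeasurable_weightedModulus_exp_neg h X hb θ hf
  have key : ENNReal.ofReal (t ^ (-θ) * b t) * modulus X f t ≤ C * (T / m) := by
    refine le_mul_of_forall_nnreal_lt hC0 fun c hc => ?_
    rw [ENNReal.div_lt_iff (Or.inl hm0) (Or.inl hmt)] at hc
    obtain ⟨u, hu, huc⟩ := E.exists_le_of_nrm_lt measurableSet_Ioc hG
      (lt_of_lt_of_le hc (mul_le_mul_right hmJ (c : ℝ≥0∞)))
    have h1 : t ≤ Real.exp (-u) := by
      rw [← Real.log_le_iff_le_exp ht]; linarith [hu.2]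
    have h2 : Real.exp (-u) ≤ Real.exp 1 * t := by
      rw [← Real.exp_log ht, ← Real.exp_add]
      exact Real.exp_le_exp.2 (by linarith [hu.1])
    exact (hC X f hf t t _ ht le_rfl h1 h2).trans (by gcongr)
  have hbt := hb.pos t ht
  have htθ := Real.rpow_pos_of_pos ht θ
  have h1 : ENNReal.ofReal (t ^ θ / b t) * ENNReal.ofReal (t ^ (-θ) * b t) = 1 := by
    rw [← ENNReal.ofReal_mul (by positivity), Real.rpow_neg ht.le, ← ENNReal.ofReal_one]
    congr 1
    field_simp
  calc modulus X f t
      = ENNReal.ofReal (t ^ θ / b t) * (ENNReal.ofReal (t ^ (-θ) * b t) * modulus X f t) := by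
        rw [← mul_assoc, h1, one_mul]
    _ ≤ ENNReal.ofReal (t ^ θ / b t) * (C * (T / m)) := by gcongr
    _ = _ := by
        rw [ENNReal.coe_mul, ENNReal.coe_inv (ENNReal.toNNReal_ne_zero.2 ⟨hm0, hmt⟩),
          ENNReal.coe_toNNReal hmt, ENNReal.div_eq_inv_mul (a := T)]
        ring

theorem exists_rpow_le_nrm_ball (h : IsRDSpace μ k n) [Nonempty Ω] (hnc : IsNonCollapsing μ)
    (X : RISpace μ) {γ : ℝ} (hγ : AlmostDecreasing fun t => X.fundamental t / t ^ γ) :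
    ∃ c : ℝ, 0 < c ∧ ∀ (x : Ω) (r : ℝ), 0 < r → r ≤ 1 →
      ENNReal.ofReal (c * r ^ (γ * n)) ≤ X.nrm ((Metric.ball x r).indicator fun _ => 1) := by
  obtain ⟨c, hc, hcB⟩ := h.exists_ball_lower hnc
  obtain ⟨C, hC, hCφ⟩ := hγ.exists_le
  have hφ := X.fundamental_pos h one_pos
  -- The cap at 1 gives s = c₁ r^n ≤ 1, so that φ_X(s)/s^γ can be compared with its value φ_X(1) at
  -- 1.
  set c₁ := min c 1
  have hc₁ : 0 < c₁ := lt_min hc one_pos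
  refine ⟨X.fundamental 1 / C * c₁ ^ γ, by positivity, fun x r hr hr1 => ?_⟩
  have hrn : 0 < r ^ n := Real.rpow_pos_of_pos hr n
  have hs : 0 < c₁ * r ^ n := by positivity
  have hs1 : c₁ * r ^ n ≤ 1 :=
    mul_le_one₀ (min_le_right _ _) hrn.le (Real.rpow_le_one hr.le hr1 h.n_pos.le)
  refine le_trans (ENNReal.ofReal_le_ofReal ?_) (X.ofReal_fundamental_le h hs measurableSet_ball
    ((ENNReal.ofReal_le_ofReal ?_).trans (hcB x r hr hr1)))
  · have h1 := hCφ _ 1 hs hs1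
    have hsγ := Real.rpow_pos_of_pos hs γ
    rw [Real.one_rpow, div_one, ← mul_div_assoc, le_div_iff₀ hsγ] at h1
    rw [mul_comm γ, Real.rpow_mul hr.le, mul_assoc, ← Real.mul_rpow hc₁.le hrn.le, div_mul_eq_mul_div,
      div_le_iff₀ hC]
    linarith
  · gcongr
    exact min_le_left _ _

theorem exists_modulus_div_nrm_ball_le (h : IsRDSpace μ k n) [Nonempty Ω]
    (hnc : IsNonCollapsing μ) (X : RISpace μ) (E : Parameter) {b : ℝ → ℝ} (hb : SlowlyVarying b)
    {θ γ : ℝ} (hθ : 0 < θ) (hγ : AlmostDecreasing fun t => X.fundamental t / t ^ γ) :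
    ∃ C : ℝ≥0, ∀ f : Ω → ℝ, AEMeasurable f μ → ∀ (x : Ω) (r : ℝ), 0 < r → r ≤ 1 / 16 →
      modulus X f (4 * r) / X.nrm ((Metric.ball x r).indicator fun _ => 1) ≤
        C * tildeNormZeroOne E (weightedModulus X θ b f) *
          ENNReal.ofReal (r ^ (θ - γ * n) / b r) := by
  obtain ⟨C, hC⟩ := exists_modulus_le_rpow h X E hb hθ
  obtain ⟨c, hc, hcB⟩ := exists_rpow_le_nrm_ball h hnc X hγ
  obtain ⟨C₂, hC₂0, hC₂⟩ := hb.exists_le (L := 4) (by norm_num)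
  refine ⟨C * (4 ^ θ * C₂ / c).toNNReal, fun f hf x r hr hr1 => ?_⟩
  set T := tildeNormZeroOne E (weightedModulus X θ b f)
  have hbr := hb.pos r hr
  have hb4 := hb.pos (4 * r) (by positivity)
  have hreal : (4 * r) ^ θ / b (4 * r) / (c * r ^ (γ * n)) ≤
      (4 ^ θ * C₂ / c) * (r ^ (θ - γ * n) / b r) := by
    have h1 := hC₂ r (4 * r) hr (by linarith) (by linarith)
    have h2 := Real.rpow_pos_of_pos hr (γ * n)
    have h3 := Real.rpow_pos_of_pos hr θ
    rw [Real.rpow_sub hr, Real.mul_rpow (by norm_num) hr.le]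
    have h4 : 1 / b (4 * r) ≤ C₂ / b r := by
      rw [div_le_div_iff₀ hb4 hbr]; linarith
    calc 4 ^ θ * r ^ θ / b (4 * r) / (c * r ^ (γ * n))
        = (4 ^ θ * r ^ θ / (c * r ^ (γ * n))) * (1 / b (4 * r)) := by field_simp
      _ ≤ (4 ^ θ * r ^ θ / (c * r ^ (γ * n))) * (C₂ / b r) := by gcongr
      _ = _ := by field_simp
  calc modulus X f (4 * r) / X.nrm ((Metric.ball x r).indicator fun _ => 1)
      ≤ (C * T * ENNReal.ofReal ((4 * r) ^ θ / b (4 * r))) / ENNReal.ofReal (c * r ^ (γ * n)) :=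
        ENNReal.div_le_div (hC f hf _ (by positivity) (by linarith)) (hcB x r hr (by linarith))
    _ = C * T * ENNReal.ofReal ((4 * r) ^ θ / b (4 * r) / (c * r ^ (γ * n))) := by
        rw [ENNReal.ofReal_div_of_pos (y := c * r ^ (γ * n)) (by positivity), mul_div_assoc]
    _ ≤ C * T * ENNReal.ofReal ((4 ^ θ * C₂ / c) * (r ^ (θ - γ * n) / b r)) := by gcongr
    _ = _ := by
        rw [ENNReal.ofReal_mul (by positivity), ENNReal.coe_mul, ENNReal.ofReal]
        ring

/-- The local estimate is stated at dyadic scales. The uniform bound comes from the mean at the top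
scale 1/16, controlled by both parts of the norm, plus the full tail of oscillations. The scale 1/16
makes 4r ≤ 1/4. -/
theorem exists_representative_edist_le (h : IsRDSpace μ k n) [Nonempty Ω]
    (hnc : IsNonCollapsing μ) (X : RISpace μ) (E : Parameter) {b : ℝ → ℝ} (hb : SlowlyVarying b)
    {θ γ : ℝ} (hθ : 0 < θ) (hγn : γ < θ / n)
    (hγ : AlmostDecreasing fun t => X.fundamental t / t ^ γ) :
    ∃ C : ℝ≥0, ∀ f : Ω → ℝ, MemBesov X E θ b f → ∃ g : Ω → ℝ, f =ᵐ[μ] g ∧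
      (∀ (j : ℕ) (x y : Ω), dist x y ≤ 1 / 16 * (1 / 2) ^ j → edist (g x) (g y) ≤
        C * besovNorm X E θ b f * ENNReal.ofReal
          ((1 / 16 * (1 / 2) ^ j) ^ (θ - γ * n) / b (1 / 16 * (1 / 2) ^ j))) ∧
      ∀ x, ‖g x‖ₑ ≤ C * besovNorm X E θ b f := by
  have hσ : 0 < θ - γ * n := by
    rw [lt_div_iff₀ h.n_pos] at hγn
    linarith
  obtain ⟨C₁, hC₁⟩ := exists_modulus_div_nrm_ball_le h hnc X E hb hθ hγ
  obtain ⟨C₂, hC₂⟩ := exists_edist_average_average_le h (L := 2) (by norm_num)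
  obtain ⟨C₃, hC₃0, hC₃⟩ := hb.exists_tsum_rpow_div_le hσ
  obtain ⟨C₄, hC₄⟩ := exists_enorm_average_le h
  obtain ⟨c, hc, hcB⟩ := exists_rpow_le_nrm_ball h hnc X hγ
  set R : ℝ := 1 / 16 with hR
  let ψ : ℝ → ℝ := fun r => r ^ (θ - γ * n) / b r
  have hcR : 0 < c * R ^ (γ * n) := by positivity
  set M₁ : ℝ≥0 := C₂ * C₁ * C₃.toNNReal
  set M₂ : ℝ≥0 := C₄ * ((c * R ^ (γ * n)).toNNReal⁻¹ + C₁ * (ψ R).toNNReal) +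
    M₁ * (ψ R).toNNReal
  refine ⟨3 * M₁ + M₂, fun f hf => ?_⟩
  have hfm := hf.1.aemeasurable
  have hfi := hf.1.integrableOn_ball h
  set T := tildeNormZeroOne E (weightedModulus X θ b f)
  have hT : T ≠ ∞ := hf.1.2.1.ne
  have hTB : T ≤ besovNorm X E θ b f := le_self_add
  have hXB : X.realNorm f ≤ besovNorm X E θ b f := le_add_self
  let D : ℕ → ℝ≥0∞ := fun j => C₂ * (C₁ * T * ENNReal.ofReal (ψ (R * (1 / 2) ^ j)))
  have htail : ∀ j, ∑' i, D (j + i) ≤ M₁ * T * ENNReal.ofReal (ψ (R * (1 / 2) ^ j)) := by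
    intro j
    simp only [D]
    rw [ENNReal.tsum_mul_left, ENNReal.tsum_mul_left]
    have h1 : ∑' i, ENNReal.ofReal (ψ (R * (1 / 2) ^ (j + i))) ≤
        ENNReal.ofReal (C₃ * ψ (R * (1 / 2) ^ j)) := by
      have := hC₃ (R * (1 / 2) ^ j) (by positivity)
      simpa only [pow_add, mul_assoc] using this
    calc _ ≤ C₂ * (C₁ * T * ENNReal.ofReal (C₃ * ψ (R * (1 / 2) ^ j))) := by gcongr
      _ = _ := by
        rw [ENNReal.ofReal_mul hC₃0.le]
        simp only [M₁, ENNReal.coe_mul, ENNReal.ofReal]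
        ring
  have hD : ∑' j, D j ≠ ∞ := by
    have h1 := htail 0
    simp only [zero_add] at h1
    exact ne_top_of_le_ne_top (by finiteness) h1
  have hr16 : ∀ j : ℕ, R * (1 / 2) ^ j ≤ 1 / 16 := fun j =>
    mul_le_of_le_one_right (by positivity) (pow_le_one₀ (by norm_num) (by norm_num))
  obtain ⟨g, hfg, hAg, hg⟩ := exists_representative_of_average_osc h hfi (R := R) (q := 1 / 2)
    (by positivity) (by norm_num) (by norm_num) hD (fun j x y s s' hs hs1 hs' hs1' hxy => by
      have hr : 0 < R * (1 / 2) ^ j := by positivity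
      rw [pow_succ] at hs hs'
      refine (hC₂ X f hfm hfi x y _ s s' hr (by linarith) hs1 (by linarith) hs1' hxy).trans ?_
      simp only [D]
      gcongr
      exact hC₁ f hfm x _ hr (hr16 j))
  refine ⟨g, hfg, fun j x y hxy => ?_, fun x => ?_⟩
  · calc edist (g x) (g y) ≤ 3 * ∑' i, D (j + i) := hg j x y hxy
      _ ≤ 3 * (M₁ * besovNorm X E θ b f * ENNReal.ofReal (ψ (R * (1 / 2) ^ j))) := by
          gcongr
          exact (htail j).trans (by gcongr)
      _ = (3 * M₁ : ℝ≥0) * besovNorm X E θ b f * ENNReal.ofReal (ψ (R * (1 / 2) ^ j)) := by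
          push_cast
          ring
      _ ≤ _ := by
          simp only [ψ]
          gcongr
          exact le_self_add
  · have h1 := hAg 0 x
    have h2 := htail 0
    simp only [zero_add, pow_zero, mul_one] at h1 h2
    have h3 := hC₄ X f hfm hfi x R (by positivity)
    rw [ENNReal.add_div] at h3
    have h4 : X.realNorm f / X.nrm ((Metric.ball x R).indicator fun _ => 1) ≤
        ((c * R ^ (γ * n)).toNNReal⁻¹ : ℝ≥0) * besovNorm X E θ b f := by
      rw [ENNReal.coe_inv (by simpa using hcR), mul_comm, ← div_eq_mul_inv]
      exact ENNReal.div_le_div hXB (hcB x R (by positivity) (by norm_num [hR]))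
    have h5 := hC₁ f hfm x R (by positivity) le_rfl
    calc ‖g x‖ₑ = edist (g x) 0 := (edist_zero_right _).symm
      _ ≤ edist (⨍ w in Metric.closedBall x R, f w ∂μ) (g x) +
            edist (⨍ w in Metric.closedBall x R, f w ∂μ) 0 := edist_triangle_left _ _ _
      _ ≤ M₁ * besovNorm X E θ b f * ENNReal.ofReal (ψ R) +
            C₄ * (((c * R ^ (γ * n)).toNNReal⁻¹ : ℝ≥0) * besovNorm X E θ b f +
              C₁ * besovNorm X E θ b f * ENNReal.ofReal (ψ R)) := by
          rw [edist_zero_right]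
          refine add_le_add ((h1.trans h2).trans (by gcongr)) (h3.trans ?_)
          gcongr
          exact h5.trans (by gcongr)
      _ = M₂ * besovNorm X E θ b f := by
          simp only [M₂, ENNReal.coe_add, ENNReal.coe_mul, ENNReal.ofReal]
          ring
      _ ≤ _ := by
          gcongr
          exact le_add_self

theorem exists_hoelder_representative (h : IsRDSpace μ k n) (hnc : IsNonCollapsing μ)
    (X : RISpace μ) (E : Parameter) {b : ℝ → ℝ} (hb : SlowlyVarying b)
    {θ γ : ℝ} (hθ : 0 < θ) (hγn : γ < θ / n)
    (hγ : AlmostDecreasing fun t => X.fundamental t / t ^ γ) :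
    ∃ C : ℝ, 0 < C ∧ ∀ f : Ω → ℝ, MemBesov X E θ b f →
      ∃ g : Ω → ℝ, f =ᵐ[μ] g ∧ ∀ x y : Ω, x ≠ y →
        |g x - g y| ≤ C * (besovNorm X E θ b f).toReal *
          (dist x y ^ (θ - γ * n) / b (dist x y)) := by
  rcases isEmpty_or_nonempty Ω with he | hne
  · exact ⟨1, one_pos, fun f _ => ⟨f, ae_eq_refl _, fun x => isEmptyElim x⟩⟩
  have hσ : 0 < θ - γ * n := by
    rw [lt_div_iff₀ h.n_pos] at hγn
    linarith
  obtain ⟨C, hC⟩ := exists_representative_edist_le h hnc X E hb hθ hγn hγ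
  obtain ⟨C₁, hC₁0, hC₁⟩ := hb.exists_rpow_div_le hσ
  obtain ⟨C₂, hC₂0, hC₂⟩ := hb.exists_le (L := 2) (by norm_num)
  let ψ : ℝ → ℝ := fun r => r ^ (θ - γ * n) / b r
  have hψ : ∀ r, 0 < r → 0 < ψ r := fun r hr => div_pos (Real.rpow_pos_of_pos hr _) (hb.pos r hr)
  have hψR := hψ (1 / 16) (by norm_num)
  refine ⟨C * (2 ^ (θ - γ * n) * C₂) + 2 * C * (C₁ / ψ (1 / 16)) + 1, by positivity,
    fun f hf => ?_⟩
  obtain ⟨g, hfg, hg, hgb⟩ := hC f hf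
  refine ⟨g, hfg, fun x y hxy => ?_⟩
  have hBt : besovNorm X E θ b f ≠ ∞ := ENNReal.add_ne_top.2 ⟨hf.1.2.1.ne, hf.2.ne⟩
  set B := (besovNorm X E θ b f).toReal
  have hBB : besovNorm X E θ b f = ENNReal.ofReal B := (ENNReal.ofReal_toReal hBt).symm
  have hB : 0 ≤ B := ENNReal.toReal_nonneg
  have hd : 0 < dist x y := dist_pos.2 hxy
  have hψd := hψ _ hd
  have hC0 : (0 : ℝ) ≤ C := C.2
  change |g x - g y| ≤ _ * B * ψ (dist x y)
  have habs : ∀ {a : ℝ}, 0 ≤ a → edist (g x) (g y) ≤ ENNReal.ofReal a → |g x - g y| ≤ a := by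
    intro a ha hle
    rwa [edist_dist, ENNReal.ofReal_le_ofReal_iff ha, Real.dist_eq] at hle
  have t1 : 0 ≤ C * (2 ^ (θ - γ * n) * C₂) * B * ψ (dist x y) := by positivity
  have t2 : 0 ≤ 2 * C * (C₁ / ψ (1 / 16)) * B * ψ (dist x y) := by positivity
  have t3 : 0 ≤ B * ψ (dist x y) := by positivity
  rcases le_or_gt (dist x y) (1 / 16) with hle | hgt
  -- Close points: the dyadic scale r with d ≤ r ≤ 2d, where r^{θ-γn}/b(r) is bounded by a multiple
  -- of its value at d.
  · obtain ⟨j, hj, hj'⟩ := exists_nat_pow_near_of_lt_one (x := 16 * dist x y) (y := 1 / 2)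
      (by positivity) (by linarith) (by norm_num) (by norm_num)
    set r : ℝ := 1 / 16 * (1 / 2) ^ j
    have hr : 0 < r := by positivity
    have hdr : dist x y ≤ r := by simp only [r]; linarith
    have hrd : r ≤ 2 * dist x y := by
      rw [pow_succ] at hj
      simp only [r]
      linarith
    have h1 := hg j x y hdr
    rw [hBB, ← ENNReal.ofReal_coe_nnreal, ← ENNReal.ofReal_mul hC0,
      ← ENNReal.ofReal_mul (by positivity)] at h1
    have h2 := habs (by have := (hψ r hr).le; positivity) h1
    have h3 : ψ r ≤ 2 ^ (θ - γ * n) * C₂ * ψ (dist x y) := by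
      have hbr := hb.pos r hr
      have hbd := hb.pos _ hd
      have h4 : r ^ (θ - γ * n) ≤ 2 ^ (θ - γ * n) * dist x y ^ (θ - γ * n) := by
        rw [← Real.mul_rpow (by norm_num) hd.le]
        exact Real.rpow_le_rpow hr.le hrd hσ.le
      have h5 := hC₂ (dist x y) r hd (by linarith) hrd
      have h6 : 1 / b r ≤ C₂ / b (dist x y) := by
        rw [div_le_div_iff₀ hbr hbd]; linarith
      calc ψ r = r ^ (θ - γ * n) * (1 / b r) := by simp only [ψ]; ring
        _ ≤ (2 ^ (θ - γ * n) * dist x y ^ (θ - γ * n)) * (C₂ / b (dist x y)) := by gcongr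
        _ = _ := by simp only [ψ]; ring
    have h4 : C * B * ψ r ≤ C * B * (2 ^ (θ - γ * n) * C₂ * ψ (dist x y)) := by gcongr
    have h5 : |g x - g y| ≤ C * B * ψ r := h2
    linarith
  -- Distant points: the uniform bound on g suffices, since r^{θ-γn}/b(r) is almost increasing and
  -- hence bounded below on r > 1/16.
  · have h1 : edist (g x) (g y) ≤ ENNReal.ofReal (2 * C * B) := by
      calc edist (g x) (g y) ≤ edist (g x) 0 + edist (g y) 0 := edist_triangle_right _ _ _
        _ ≤ C * besovNorm X E θ b f + C * besovNorm X E θ b f := by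
            rw [edist_zero_right, edist_zero_right]
            exact add_le_add (hgb x) (hgb y)
        _ = _ := by
            rw [hBB, ← ENNReal.ofReal_coe_nnreal, ← ENNReal.ofReal_mul hC0,
              ← ENNReal.ofReal_add (by positivity) (by positivity)]
            congr 1
            ring
    have h2 := habs (by positivity) h1
    have h3 : ψ (1 / 16) ≤ C₁ * ψ (dist x y) := hC₁ _ _ (by norm_num) hgt.le
    have h4 : 1 ≤ C₁ / ψ (1 / 16) * ψ (dist x y) := by
      rw [div_mul_eq_mul_div, le_div_iff₀ hψR]
      linarith
    have h5 : 2 * C * B * 1 ≤ 2 * C * B * (C₁ / ψ (1 / 16) * ψ (dist x y)) := by gcongr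
    linarith

end Hoelder

end HajlaszBesov

theorem mainTheorem7 {Ω : Type*} [MetricSpace Ω] [MeasurableSpace Ω] [BorelSpace Ω]
    (μ : Measure Ω) (k n : ℝ) (hRD : IsRDSpace μ k n) (hnc : IsNonCollapsing μ)
    (X : RISpace μ) (E : Parameter) (b : ℝ → ℝ) (hb : SlowlyVarying b)
    (θ : ℝ) (hθ₀ : 0 < θ) (hθ₁ : θ < 1) :
    (HasLowerIndex X.fundamental (θ / n) →
      tildeAssocNormZeroOne E
        (fun t => ENNReal.ofReal (t ^ (θ / n) / (b (t ^ (1 / n)) * X.fundamental t))) < ∞ →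
      ∀ f : Ω → ℝ, MemBesov X E θ b f → EssentiallyContinuous μ f) ∧
    (∀ βl βu γ : ℝ, HasLowerIndex X.fundamental βl → HasUpperIndex X.fundamental βu →
      βl < θ / n → βu ≤ γ → γ ≤ 1 → γ < θ / n →
      AlmostDecreasing (fun t => X.fundamental t / t ^ γ) →
      ∃ C : ℝ, 0 < C ∧ ∀ f : Ω → ℝ, MemBesov X E θ b f →
        ∃ g : Ω → ℝ, f =ᵐ[μ] g ∧ ∀ x y : Ω, x ≠ y →
          |g x - g y| ≤ C * (besovNorm X E θ b f).toReal *
            (dist x y ^ (θ - γ * n) / b (dist x y))) := by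
  exact ⟨fun _ hE f hf => essentiallyContinuous_of_memBesov hRD hnc X E hb hθ₀ hE hf,
    fun _ _ γ _ _ _ _ _ hγn hγ => exists_hoelder_representative hRD hnc X E hb hθ₀ hγn hγ⟩
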